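/- **Conventions.** Inner products are positive definite and linear in the first variable. $C^\infty(S^1)$ is the space of smooth functions $S^1\to\mathbb C$ with its usual Fréchet topology, and $\hat f(n)=\frac1{2\pi}\int_0^{2\pi}f(e^{i\theta})e^{-in\theta}\,d\theta$. A *Möbius vertex algebra* is a complex vector space $\mathcal V$ with operators $L_{-1},L_0,L_1$ satisfying $[L_m,L_n]=(m-n)L_{m+n}$ for $m,n\in\{-1,0,1\}$ with $|m+n|\le 1$, a linear map $Y:\mathcal V\to \mathrm{End}(\mathcal V)[[z^{\pm1}]]$ and a vector $\Omega\in\mathcal V$, such that: (1) $\mathcal V=\bigoplus_{n\ge0}\mathcal V(n)$ with $\mathcal V(n)=\ker(L_0-n)$ finite-dimensional; (2) $L_k\Omega=0$ for $k=-1,0,1$ and $Y(\Omega,z)=\mathrm{Id}$; (3) for all $v\in\mathcal V$, $Y(v,z)\Omega$ has only non-negative powers of $z$, and its constant term is $v$; (4) $[L_k,Y(v,z)]=\sum_{j=0}^{k+1}\binom{k+1}{j}z^{k+1-j}Y(L_{j-1}v,z)$ for $k=-1,0,1$, and $Y(L_{-1}v,z)=\frac{d}{dz}Y(v,z)$; (5)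 for all $v,u\in\mathcal V$, $(z-w)^N[Y(v,z),Y(u,w)]=0$ for $N$ sufficiently large. Write $Y(v,z)=\sum_{m\in\mathbb Z} v_{(m)}z^{-m-1}$, and put $v_n=v_{(n+d-1)}$ for $v\in\mathcal V(d)$, extended linearly in $v$. A *unitary Möbius vertex algebra* is a Möbius vertex algebra with an inner product $\langle\cdot,\cdot\rangle$ and an antilinear bijection $\Theta:\mathcal V\to\mathcal V$ that fixes $\Omega$, commutes with the $L_m$ and satisfies $\Theta(v_{(n)}u)=(\Theta v)_{(n)}\Theta u$, such that $\langle L_{-n}v,u\rangle=\langle v,L_nu\rangle$ for $n=-1,0,1$, $\|\Omega\|=1$, and the bilinear form $(u,u')=\langle u,\Theta u'\rangle$ is invariant: $(Y(v,z)u,u')=(u,Y(e^{zL_1}(-z^{-2})^{L_0}v,z^{-1})u')$. Let $\mathcal H$ be the Hilbert space completion of $\mathcal V$. For $v\in\mathcal V$ and $f\in C^\infty(S^1)$ let $Y^0(v,f)u=\sum_{n\in\mathbb Z}\hat f(n)\,v_nu$ for $u\in\mathcal V$ (sum in $\mathcal H$), regarded as an unbounded operator on $\mathcal H$, and let $Y(v,f)$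 be its closure. An *operator-valued distribution* on $S^1$ with domain a dense subspace $\mathcal D\subseteq\mathcal H$ is a continuous linear map $\varphi:C^\infty(S^1)\to\mathrm{Hom}(\mathcal D,\mathcal H)$, where $\mathrm{Hom}(\mathcal D,\mathcal H)$ (all linear maps) has the topology of pointwise convergence. It is *adjointable* on $\mathcal D$ if there is an operator-valued distribution $\varphi^\dagger$ with domain $\mathcal D$ (then unique) such that $\langle\varphi(f)\Phi,\Psi\rangle=\langle\Phi,\varphi^\dagger(\overline f)\Psi\rangle$ for all $f\in C^\infty(S^1)$ and $\Phi,\Psi\in\mathcal D$. **Corollary.** Let $\mathcal V$ be a unitary Möbius vertex algebra. For all $v\in\mathcal V$ and $f\in C^\infty(S^1)$, the sum defining $Y^0(v,f)u$ converges in $\mathcal H$ for every $u\in\mathcal V$, and $Y^0(v,f)$ is closable. Let $$\mathcal D=\operatorname{Span}\{Y(v^k,f_k)\cdots Y(v^1,f_1)\Omega : k\ge0,\ v^j\in\mathcal V,\ f_j\in C^\infty(S^1)\}.$$ Then $\mathcal D$ is dense in $\mathcal H$ and is contained in the domain of every $Y(v,f)$ (so in particular all the products above are defined), and for each $v\in\mathcal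 V$ the assignment $\varphi_v(f)=Y(v,f)|_{\mathcal D}$ is an adjointable operator-valued distribution on $\mathcal D$. Its adjoint is $\varphi_v^\dagger=\varphi_{\tilde v}$, where $\tilde v=e^{L_1}(-1)^{L_0}\Theta v$. -/

import Mathlib

open scoped ContDiff Manifold

noncomputable section

/-! ### Smooth functions on the circle -/

/-- The complex vector space of smooth functions `S¹ → ℂ`. -/
def smoothSubmodule : Submodule ℂ (Circle → ℂ) where
  carrier := {f | ContMDiff (𝓡 1) (modelWithCornersSelf ℝ ℂ) ∞ f}
  add_mem' := fun hf hg => ContMDiff.add hf hg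
  zero_mem' := contMDiff_const
  smul_mem' := fun c _ hf =>
    ((c • ContinuousLinearMap.id ℝ ℂ : ℂ →L[ℝ] ℂ).contMDiff (n := ∞)).comp hf

/-- The space `C^∞(S¹)` of test functions. -/
def TestFn : Type := ↥smoothSubmodule

namespace TestFn

instance : AddCommGroup TestFn := inferInstanceAs (AddCommGroup ↥smoothSubmodule)
instance : Module ℂ TestFn := inferInstanceAs (Module ℂ ↥smoothSubmodule)
instance : CoeFun TestFn (fun _ => Circle → ℂ) := ⟨fun f => f.1⟩

/-- The `2π`-periodic function `θ ↦ f (e^{iθ})`. -/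
def lift (f : TestFn) (θ : ℝ) : ℂ := f (Circle.exp θ)

theorem lift_add (f g : TestFn) : (f + g).lift = f.lift + g.lift := rfl

theorem lift_smul (c : ℂ) (f : TestFn) : (c • f).lift = c • f.lift := rfl

theorem contDiff_lift (f : TestFn) : ContDiff ℝ ∞ f.lift :=
  contMDiff_iff_contDiff.1 (ContMDiff.comp f.2 contMDiff_circleExp)

theorem periodic_lift (f : TestFn) : Function.Periodic f.lift (2 * Real.pi) := fun θ => by
  simp only [lift, Circle.periodic_exp θ]

theorem bddAbove_iteratedDeriv (f : TestFn) (k : ℕ) :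
    BddAbove (Set.range fun θ : ℝ => ‖iteratedDeriv k f.lift θ‖) := by
  have hc : Continuous (iteratedDeriv k f.lift) :=
    f.contDiff_lift.continuous_iteratedDeriv k (by exact_mod_cast le_top)
  have hp : Function.Periodic (iteratedDeriv k f.lift) (2 * Real.pi) := fun θ => by
    have h := congrFun (iteratedDeriv_comp_add_const k f.lift (2 * Real.pi)) θ
    rw [← h, funext f.periodic_lift]
  obtain ⟨C, hC⟩ := (hp.isBounded_of_continuous Real.two_pi_pos.ne' hc).exists_norm_le
  exact ⟨C, by rintro _ ⟨θ, rfl⟩; exact hC _ ⟨θ, rfl⟩⟩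

/-- The seminorm `f ↦ sup_θ |(d/dθ)^k f(e^{iθ})|` on `C^∞(S¹)`. -/
def supSeminorm (k : ℕ) : Seminorm ℂ TestFn :=
  Seminorm.of (fun f => ⨆ θ : ℝ, ‖iteratedDeriv k f.lift θ‖)
    (fun f g => by
      refine ciSup_le fun θ => ?_
      have hf : ContDiffAt ℝ k f.lift θ :=
        (f.contDiff_lift.of_le (by exact_mod_cast le_top)).contDiffAt
      have hg : ContDiffAt ℝ k g.lift θ :=
        (g.contDiff_lift.of_le (by exact_mod_cast le_top)).contDiffAt
      rw [lift_add, iteratedDeriv_add hf hg]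
      exact (norm_add_le _ _).trans (add_le_add (le_ciSup (f.bddAbove_iteratedDeriv k) θ)
        (le_ciSup (g.bddAbove_iteratedDeriv k) θ)))
    (fun c f => by
      have hf (θ : ℝ) : ContDiffAt ℝ k f.lift θ :=
        (f.contDiff_lift.of_le (by exact_mod_cast le_top)).contDiffAt
      have h (θ : ℝ) : ‖iteratedDeriv k (c • f).lift θ‖ = ‖c‖ * ‖iteratedDeriv k f.lift θ‖ := by
        rw [lift_smul, iteratedDeriv_const_smul_field, norm_smul]
      simp only [h]
      rw [Real.mul_iSup_of_nonneg (norm_nonneg c)])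

/-- The usual Fréchet topology of `C^∞(S¹)`: uniform convergence of all derivatives. -/
instance : TopologicalSpace TestFn :=
  (SeminormFamily.moduleFilterBasis (𝕜 := ℂ) supSeminorm).topology

theorem withSeminorms : WithSeminorms supSeminorm := ⟨rfl⟩

/-- The complex conjugate of a test function. -/
def conj (f : TestFn) : TestFn :=
  ⟨fun z => starRingEnd ℂ (f z), (Complex.conjCLE.toContinuousLinearMap.contMDiff (n := ∞)).comp f.2⟩

/-- The `n`-th Fourier coefficient `(2π)⁻¹ ∫₀^{2π} f(e^{iθ}) e^{-inθ} dθ`. -/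
def fourier (f : TestFn) (n : ℤ) : ℂ :=
  (2 * Real.pi : ℂ)⁻¹ *
    ∫ θ in (0 : ℝ)..(2 * Real.pi), f.lift θ * Complex.exp (-(Complex.I * n * θ))

theorem fourier_add (f g : TestFn) (n : ℤ) : (f + g).fourier n = f.fourier n + g.fourier n := by
  have hc (h : TestFn) : IntervalIntegrable
      (fun θ : ℝ => h.lift θ * Complex.exp (-(Complex.I * n * θ)))
      MeasureTheory.volume 0 (2 * Real.pi) :=
    (h.contDiff_lift.continuous.mul (by fun_prop)).intervalIntegrable _ _
  simp only [fourier, lift_add, Pi.add_apply, add_mul]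
  rw [intervalIntegral.integral_add (hc f) (hc g), mul_add]

end TestFn

/-! ### Formal series -/

/-- `W[[z^{±1}]]`: the value at `n` is the coefficient of `z ^ n`. -/
abbrev FormalSeries (W : Type*) := ℤ → W

namespace FormalSeries

variable {W : Type*} [AddCommGroup W]

/-- Multiplication by `z ^ k`. -/
def zpowMul (k : ℤ) (A : FormalSeries W) : FormalSeries W := fun n => A (n - k)

/-- The formal derivative `d/dz`. -/
def derivative (A : FormalSeries W) : FormalSeries W := fun n => (n + 1) • A (n + 1)

/-- Multiplication by `z - w` of a formal series in `z^{±1}, w^{±1}`. -/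
def subMul (B : ℤ → ℤ → W) : ℤ → ℤ → W := fun m n => B (m - 1) n - B m (n - 1)

end FormalSeries

/-! ### Möbius vertex algebras -/

open FormalSeries in
/-- An `ℕ`-graded Möbius vertex algebra structure on a complex vector space `V`. -/
structure MoebiusVertexAlgebra (V : Type*) [AddCommGroup V] [Module ℂ V] where
  /-- The operator `L₋₁`. -/
  Lneg : Module.End ℂ V
  /-- The operator `L₀`. -/
  Lzero : Module.End ℂ V
  /-- The operator `L₁`. -/
  Lone : Module.End ℂ V
  lie_one_neg : ⁅Lone, Lneg⁆ = (2 : ℂ) • Lzero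
  lie_one_zero : ⁅Lone, Lzero⁆ = Lone
  lie_zero_neg : ⁅Lzero, Lneg⁆ = Lneg
  /-- The state-field correspondence `v ↦ Y(v, z)`. -/
  Y : V →ₗ[ℂ] FormalSeries (Module.End ℂ V)
  /-- The vacuum vector. -/
  vac : V
  /-- `V` is the direct sum of the spaces `V(n) = ker (L₀ - n)`, `n ≥ 0`. -/
  isInternal : DirectSum.IsInternal fun n : ℕ => Module.End.eigenspace Lzero (n : ℂ)
  finiteDimensional : ∀ n : ℕ, FiniteDimensional ℂ (Module.End.eigenspace Lzero (n : ℂ))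
  Lneg_vac : Lneg vac = 0
  Lzero_vac : Lzero vac = 0
  Lone_vac : Lone vac = 0
  Y_vac : Y vac = Pi.single 0 1
  /-- `Y(v, z)Ω` has only non-negative powers of `z`, -/
  Y_apply_vac_of_neg : ∀ (v : V) (n : ℤ), n < 0 → Y v n vac = 0
  /-- and its constant term is `v`. -/
  Y_apply_vac_zero : ∀ v : V, Y v 0 vac = v
  lie_Lneg : ∀ v : V, (fun n => ⁅Lneg, Y v n⁆) = Y (Lneg v)
  lie_Lzero : ∀ v : V, (fun n => ⁅Lzero, Y v n⁆) = zpowMul 1 (Y (Lneg v)) + Y (Lzero v)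
  lie_Lone : ∀ v : V, (fun n => ⁅Lone, Y v n⁆) =
    zpowMul 2 (Y (Lneg v)) + (2 : ℂ) • zpowMul 1 (Y (Lzero v)) + Y (Lone v)
  Y_Lneg : ∀ v : V, Y (Lneg v) = derivative (Y v)
  /-- Locality: `(z - w)^N [Y(v, z), Y(u, w)] = 0` for `N` sufficiently large. -/
  locality : ∀ v u : V, ∃ N₀ : ℕ, ∀ N ≥ N₀, subMul^[N] (fun m n => ⁅Y v m, Y u n⁆) = 0

namespace MoebiusVertexAlgebra

variable {V : Type*} [AddCommGroup V] [Module ℂ V] (A : MoebiusVertexAlgebra V)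

/-- The weight space `V(n) = ker (L₀ - n)`. -/
def wt (n : ℕ) : Submodule ℂ V := Module.End.eigenspace A.Lzero (n : ℂ)

/-- The mode `v_(m)`, where `Y(v, z) = ∑ v_(m) z^{-m-1}`. -/
def mode (m : ℤ) : V →ₗ[ℂ] Module.End ℂ V := LinearMap.proj (-m - 1) ∘ₗ A.Y

/-- The isomorphism `⨁ V(n) ≃ V`. -/
def gradeEquiv : (DirectSum ℕ fun n => A.wt n) ≃ₗ[ℂ] V :=
  LinearEquiv.ofBijective (DirectSum.coeLinearMap A.wt) A.isInternal

/-- The linear map on `V` with prescribed linear restrictions to the weight spaces. -/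
def linExt {W : Type*} [AddCommGroup W] [Module ℂ W] (g : ℕ → V →ₗ[ℂ] W) : V →ₗ[ℂ] W :=
  DirectSum.toModule ℂ ℕ W (fun d => g d ∘ₗ (A.wt d).subtype) ∘ₗ A.gradeEquiv.symm.toLinearMap

theorem linExt_apply {W : Type*} [AddCommGroup W] [Module ℂ W] (g : ℕ → V →ₗ[ℂ] W)
    {d : ℕ} {v : V} (hv : v ∈ A.wt d) : A.linExt g v = g d v := by
  have h : A.gradeEquiv.symm v = DirectSum.lof ℂ ℕ (fun n => A.wt n) d ⟨v, hv⟩ := by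
    rw [LinearEquiv.symm_apply_eq]
    exact (DirectSum.coeLinearMap_lof (A.wt) d ⟨v, hv⟩).symm
  simp [linExt, h]

/-- The degree-shifted mode `v_n`: `v_n = v_(n+d-1)` for `v ∈ V(d)`, extended linearly. -/
def shiftedMode (n : ℤ) : V →ₗ[ℂ] Module.End ℂ V := A.linExt fun d => A.mode (n + d - 1)

/-- `(-1)^{L₀}`. -/
def negOnePowLzero : Module.End ℂ V := A.linExt fun d => (-1 : ℂ) ^ d • LinearMap.id

theorem Lone_mem {d : ℕ} {v : V} (hv : v ∈ A.wt (d + 1)) : A.Lone v ∈ A.wt d := by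
  have h := LinearMap.congr_fun A.lie_one_zero v
  simp only [wt, Module.End.mem_eigenspace_iff] at hv ⊢
  rw [Ring.lie_def, LinearMap.sub_apply, Module.End.mul_apply, Module.End.mul_apply, hv,
    map_smul] at h
  rw [sub_eq_iff_eq_add] at h
  push_cast at h
  rw [add_smul, one_smul, add_comm (A.Lone v)] at h
  exact (add_right_cancel h).symm

theorem Lone_eq_zero {v : V} (hv : v ∈ A.wt 0) : A.Lone v = 0 := by
  have h := LinearMap.congr_fun A.lie_one_zero v
  simp only [wt, Module.End.mem_eigenspace_iff, Nat.cast_zero, zero_smul] at hv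
  rw [Ring.lie_def, LinearMap.sub_apply, Module.End.mul_apply, Module.End.mul_apply, hv,
    map_zero, zero_sub, neg_eq_iff_eq_neg] at h
  have h2 : A.Lone v ∈ Module.End.eigenspace A.Lzero (-1 : ℂ) := by
    rw [Module.End.mem_eigenspace_iff, h, neg_smul, one_smul]
  have hd := Module.End.eigenspaces_iSupIndep A.Lzero (-1 : ℂ)
  refine Submodule.disjoint_def.1 hd _ h2 ?_
  have hle : (⨆ n : ℕ, Module.End.eigenspace A.Lzero (n : ℂ)) ≤
      ⨆ (μ : ℂ) (_ : μ ≠ -1), Module.End.eigenspace A.Lzero μ :=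
    iSup_le fun n => le_iSup₂_of_le (n : ℂ) (by
      intro hn
      have hr := congrArg Complex.re hn
      simp only [Complex.natCast_re, Complex.neg_re, Complex.one_re] at hr
      linarith [(Nat.cast_nonneg n : (0 : ℝ) ≤ n)]) le_rfl
  exact hle (A.isInternal.submodule_iSup_eq_top ▸ Submodule.mem_top)

theorem Lone_pow_eq_zero {d j : ℕ} (hj : d < j) {v : V} (hv : v ∈ A.wt d) :
    (A.Lone ^ j) v = 0 := by
  induction j generalizing d v with
  | zero => omega
  | succ j ih =>
    rw [pow_succ, Module.End.mul_apply]
    cases d with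
    | zero => rw [A.Lone_eq_zero hv, map_zero]
    | succ d => exact ih (by omega) (A.Lone_mem hv)

/-- `e^{L₁} = ∑_j L₁^j / j!`; on `V(d)` the terms with `j > d` vanish (`Lone_pow_eq_zero`). -/
def expLone : Module.End ℂ V :=
  A.linExt fun d => ∑ j ∈ Finset.range (d + 1), ((j.factorial : ℂ)⁻¹) • A.Lone ^ j

/-- An antilinear automorphism of `V`. -/
structure IsAntilinearAutomorphism (Θ : V ≃ₛₗ[starRingEnd ℂ] V) : Prop where
  map_vac : Θ A.vac = A.vac
  map_Lneg : ∀ v, Θ (A.Lneg v) = A.Lneg (Θ v)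
  map_Lzero : ∀ v, Θ (A.Lzero v) = A.Lzero (Θ v)
  map_Lone : ∀ v, Θ (A.Lone v) = A.Lone (Θ v)
  map_mode : ∀ (v u : V) (n : ℤ), Θ (A.mode n v u) = A.mode n (Θ v) (Θ u)

/-- Invariance of a bilinear form:
`(Y(v, z) u, u') = (u, Y(e^{zL₁} (-z⁻²)^{L₀} v, z⁻¹) u')`. For `v ∈ V(d)` the vector
`e^{zL₁} (-z⁻²)^{L₀} v` is `∑_j (-1)^d / j! • z^{j-2d} L₁^j v`, and the condition below compares the
coefficients of `z ^ n`. -/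
def IsInvariantForm (B : V →ₗ[ℂ] V →ₗ[ℂ] ℂ) : Prop :=
  ∀ (d : ℕ), ∀ v ∈ A.wt d, ∀ (u u' : V) (n : ℤ),
    B (A.Y v n u) u' =
      B u (∑ j ∈ Finset.range (d + 1),
        ((-1 : ℂ) ^ d * (j.factorial : ℂ)⁻¹) • A.Y ((A.Lone ^ j) v) (j - 2 * d - n) u')

end MoebiusVertexAlgebra

/-! ### Unitary Möbius vertex algebras -/

/-- The inner product, linear in the first variable. -/
def ip {E : Type*} [NormedAddCommGroup E] [InnerProductSpace ℂ E] (x y : E) : ℂ := inner ℂ y x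

/-- The bilinear form `(u, u') ↦ ⟨u, Θ u'⟩`. -/
def thetaForm {V : Type*} [NormedAddCommGroup V] [InnerProductSpace ℂ V]
    (Θ : V ≃ₛₗ[starRingEnd ℂ] V) : V →ₗ[ℂ] V →ₗ[ℂ] ℂ :=
  LinearMap.mk₂ ℂ (fun u u' => ip u (Θ u'))
    (fun u₁ u₂ u' => by simp only [ip, inner_add_right])
    (fun c u u' => by simp only [ip, inner_smul_right, smul_eq_mul])
    (fun u u₁ u₂ => by simp only [ip, map_add, inner_add_left])
    (fun c u u' => by
      simp only [ip, LinearEquiv.map_smulₛₗ, inner_smul_left, Complex.conj_conj, smul_eq_mul])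

/-- A unitary Möbius vertex algebra structure on an inner product space `V`. -/
structure UnitaryMoebiusVertexAlgebra (V : Type*) [NormedAddCommGroup V] [InnerProductSpace ℂ V]
    extends MoebiusVertexAlgebra V where
  /-- The antilinear automorphism `Θ`. -/
  Θ : V ≃ₛₗ[starRingEnd ℂ] V
  isAntilinearAutomorphism : toMoebiusVertexAlgebra.IsAntilinearAutomorphism Θ
  ip_Lneg : ∀ v u : V, ip (Lneg v) u = ip v (Lone u)
  ip_Lzero : ∀ v u : V, ip (Lzero v) u = ip v (Lzero u)
  ip_Lone : ∀ v u : V, ip (Lone v) u = ip v (Lneg u)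
  norm_vac : ‖vac‖ = 1
  invariant : toMoebiusVertexAlgebra.IsInvariantForm (thetaForm Θ)

namespace UnitaryMoebiusVertexAlgebra

variable {V : Type*} [NormedAddCommGroup V] [InnerProductSpace ℂ V]
  (A : UnitaryMoebiusVertexAlgebra V)

/-- The Hilbert space completion `H` of an inner product space `V`. -/
abbrev Hilb (V : Type*) [NormedAddCommGroup V] [InnerProductSpace ℂ V] : Type _ :=
  UniformSpace.Completion V

/-- The vector `e^{L₁} (-1)^{L₀} Θ v`. -/
def tilde (v : V) : V := A.expLone (A.negOnePowLzero (A.Θ v))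

/-- The graph of `Y⁰(v, f)`: the pairs `(u, y)` with `u ∈ V` and `y = ∑_n f̂(n) v_n u`,
the sum converging in `H`. -/
def preSmearedGraph (v : V) (f : TestFn) : Submodule ℂ (Hilb V × Hilb V) where
  carrier := {p | ∃ u : V, (u : Hilb V) = p.1 ∧
    HasSum (fun n : ℤ => f.fourier n • ((A.shiftedMode n v u : V) : Hilb V)) p.2}
  zero_mem' := ⟨0, by simp, by
    simpa only [map_zero, UniformSpace.Completion.coe_zero, smul_zero, Prod.snd_zero]
      using hasSum_zero⟩
  add_mem' := by
    rintro p q ⟨u, hu, hp⟩ ⟨w, hw, hq⟩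
    refine ⟨u + w, by rw [UniformSpace.Completion.coe_add, hu, hw, Prod.fst_add], ?_⟩
    simpa only [map_add, UniformSpace.Completion.coe_add, smul_add, Prod.snd_add] using hp.add hq
  smul_mem' := by
    rintro c p ⟨u, hu, hp⟩
    refine ⟨c • u, by rw [UniformSpace.Completion.coe_smul, hu, Prod.smul_fst], ?_⟩
    simpa only [map_smul, UniformSpace.Completion.coe_smul, smul_comm c, Prod.smul_snd] using hp.const_smul c

/-- The unbounded operator `Y⁰(v, f) u = ∑_n f̂(n) v_n u` on `H`, defined on those `u ∈ V` for
which the sum converges in `H`. -/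
def preSmeared (v : V) (f : TestFn) : Hilb V →ₗ.[ℂ] Hilb V := (A.preSmearedGraph v f).toLinearPMap

theorem mem_graph_preSmeared (v : V) (f : TestFn) (x y : Hilb V) :
    (x, y) ∈ (A.preSmeared v f).graph ↔ ∃ u : V, (u : Hilb V) = x ∧
      HasSum (fun n : ℤ => f.fourier n • ((A.shiftedMode n v u : V) : Hilb V)) y := by
  have hg : ∀ p ∈ A.preSmearedGraph v f, p.1 = 0 → p.2 = 0 := by
    rintro p ⟨u, hu, hp⟩ h0
    have hu0 : u = 0 := by
      apply UniformSpace.Completion.coe_injective V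
      rw [hu, h0, UniformSpace.Completion.coe_zero]
    subst hu0
    simp only [map_zero, UniformSpace.Completion.coe_zero, smul_zero] at hp
    exact hp.unique hasSum_zero
  rw [preSmeared, Submodule.toLinearPMap_graph_eq _ hg]
  rfl

/-- The smeared field `Y(v, f)`, the closure of `Y⁰(v, f)`. -/
def smeared (v : V) (f : TestFn) : Hilb V →ₗ.[ℂ] Hilb V := (A.preSmeared v f).closure

/-- The vectors `Y(v^k, f_k) ⋯ Y(v^1, f_1) Ω`, `k ≥ 0`. -/
inductive IsIterated : Hilb V → Prop
  | vac : IsIterated (A.vac : Hilb V)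
  | smear (v : V) (f : TestFn) (x : (A.smeared v f).domain) (hx : IsIterated (x : Hilb V)) :
      IsIterated (A.smeared v f x)

/-- The domain `D`, the span of the iterated smeared fields applied to `Ω`. -/
def D : Submodule ℂ (Hilb V) := Submodule.span ℂ {x | A.IsIterated x}

end UnitaryMoebiusVertexAlgebra

/-! ### Operator-valued distributions -/

/-- An operator-valued distribution on `S¹` with dense domain `D ⊆ E`: a linear map from `C^∞(S¹)`
to the linear maps `D → E` that is continuous for the topology of pointwise convergence on the
latter. -/
structure OperatorValuedDistribution {E : Type*} [NormedAddCommGroup E] [InnerProductSpace ℂ E]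
    (D : Submodule ℂ E) where
  dense : Dense (D : Set E)
  /-- The underlying linear map. -/
  toFun : TestFn →ₗ[ℂ] (D →ₗ[ℂ] E)
  continuous_apply : ∀ Φ : D, Continuous fun f => toFun f Φ

namespace OperatorValuedDistribution

variable {E : Type*} [NormedAddCommGroup E] [InnerProductSpace ℂ E] {D : Submodule ℂ E}

/-- `φ(f)` as an unbounded operator on `E` with domain `D`. -/
def op (φ : OperatorValuedDistribution D) (f : TestFn) : E →ₗ.[ℂ] E := ⟨D, φ.toFun f⟩

/-- `ψ` is the adjoint distribution `φ†`:
`⟨φ(f) Φ, Ψ⟩ = ⟨Φ, ψ(f̄) Ψ⟩` for all test functions `f` and `Φ, Ψ ∈ D`. -/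
def IsAdjoint (φ ψ : OperatorValuedDistribution D) : Prop :=
  ∀ (f : TestFn) (Φ Ψ : D), ip (φ.toFun f Φ) (Ψ : E) = ip (Φ : E) (ψ.toFun f.conj Ψ)

/-- `φ` is adjointable on `D`. -/
def IsAdjointable (φ : OperatorValuedDistribution D) : Prop := ∃ ψ, φ.IsAdjoint ψ

/-- The adjoint distribution `φ†`. -/
def adjoint (φ : OperatorValuedDistribution D) (h : φ.IsAdjointable) :
    OperatorValuedDistribution D := h.choose

theorem IsAdjoint.unique {φ ψ χ : OperatorValuedDistribution D} (h₁ : φ.IsAdjoint ψ)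
    (h₂ : φ.IsAdjoint χ) : ψ = χ := by
  have h : ψ.toFun = χ.toFun := by
    ext f Ψ
    have hf : f = f.conj.conj := Subtype.ext (funext fun z => (Complex.conj_conj (f.1 z)).symm)
    refine φ.dense.eq_of_inner_left (𝕜 := ℂ) fun Φ hΦ => ?_
    have h := (h₁ f.conj ⟨Φ, hΦ⟩ Ψ).symm.trans (h₂ f.conj ⟨Φ, hΦ⟩ Ψ)
    rw [← hf] at h
    exact h
  cases ψ; cases χ; simpa using h

theorem isAdjoint_adjoint (φ : OperatorValuedDistribution D) (h : φ.IsAdjointable) :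
    φ.IsAdjoint (φ.adjoint h) := h.choose_spec

end OperatorValuedDistribution

end

/-!
The smeared fields are controlled by one estimate: for fixed `v^1, …, v^k, u ∈ V`, the norm of
`v^k_{n_k} ⋯ v^1_{n_1} u` grows at most polynomially in `(n_1, …, n_k)`
(`UnitaryMoebiusVertexAlgebra.polyBounded_apply`).

The estimate rests on locality. For a functional `l` that vanishes on all high degrees, the matrix
coefficient `l (Y(a, z) Y(b^1, w_1) ⋯ Y(b^k, w_k) u)` involves only exponents of `z` that are bounded
above, since a mode with a large exponent of `z` raises the degree too much. A product of factors
`z - w_j` makes `Y(a, z)` commute with all the other fields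
(`MoebiusVertexAlgebra.FieldProduct.locality`); after moving it to the right, the exponents of `z` are
bounded below as well, because modes with a very negative exponent annihilate `u`. So after
multiplication by these factors only finitely many modes of `a` occur, each of which can be absorbed
into `l`, and polynomial growth follows by induction on `k`. The factors `z - w_j` can then be divided
out by the recursion `F (p - 1, n) = G (p, n) + F (p, n - e_j)`, which preserves polynomial growth
(`PolyBounded.of_mulSub`). Norms are matrix coefficients of a longer product because `v_n` and
`(tilde v)_{-n}` are adjoint to each other, by invariance of the form
(`UnitaryMoebiusVertexAlgebra.inner_raise_left`).

Fourier coefficients of test functions decrease rapidly, so multiple series of modes applied to the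
vacuum with such coefficients converge absolutely. Their partial sums lie in `V`, and rearranging the
absolutely convergent series shows that their sums lie in the domain of the closure `Y(v, f)` and are
mapped to sums of the same kind (`UnitaryMoebiusVertexAlgebra.IsTempered.smear`). Continuity in `f`
follows from the same bounds, and both closability and the formula for the adjoint distribution follow
from the adjointness of modes by passing to closures of graphs
(`UnitaryMoebiusVertexAlgebra.inner_closure_graph`).
-/

noncomputable section

/-! ### Polynomially bounded functions -/

/-- A function on a seminormed group has polynomial growth. -/
def PolyBounded {G E : Type*} [SeminormedAddCommGroup G] [SeminormedAddCommGroup E]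
    (F : G → E) : Prop :=
  ∃ (C : ℝ) (M : ℕ), 0 ≤ C ∧ ∀ n, ‖F n‖ ≤ C * (1 + ‖n‖) ^ M

namespace PolyBounded

variable {G G' E E' : Type*} [SeminormedAddCommGroup G] [SeminormedAddCommGroup G']
  [SeminormedAddCommGroup E] [SeminormedAddCommGroup E']

theorem const (x : E) : PolyBounded fun _ : G => x :=
  ⟨‖x‖, 0, norm_nonneg _, fun _ => by simp only [pow_zero, mul_one, le_refl]⟩

theorem mono {F : G → E} {F' : G → E'} (h : PolyBounded F') (hF : ∀ n, ‖F n‖ ≤ ‖F' n‖) :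
    PolyBounded F := by
  obtain ⟨C, M, hC, h⟩ := h
  exact ⟨C, M, hC, fun n => (hF n).trans (h n)⟩

theorem add {F F' : G → E} (h : PolyBounded F) (h' : PolyBounded F') :
    PolyBounded fun n => F n + F' n := by
  obtain ⟨C, M, hC, h⟩ := h
  obtain ⟨C', M', hC', h'⟩ := h'
  refine ⟨C + C', M + M', by positivity, fun n => ?_⟩
  have h1 : (1 : ℝ) ≤ 1 + ‖n‖ := by linarith [norm_nonneg n]
  calc ‖F n + F' n‖ ≤ C * (1 + ‖n‖) ^ M + C' * (1 + ‖n‖) ^ M' :=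
        (norm_add_le _ _).trans (add_le_add (h n) (h' n))
    _ ≤ C * (1 + ‖n‖) ^ (M + M') + C' * (1 + ‖n‖) ^ (M + M') := by
        gcongr <;> first | exact h1 | omega
    _ = _ := by ring

theorem neg {F : G → E} (h : PolyBounded F) : PolyBounded fun n => -F n :=
  h.mono fun _ => (norm_neg _).le

theorem sub {F F' : G → E} (h : PolyBounded F) (h' : PolyBounded F') :
    PolyBounded fun n => F n - F' n := by
  simpa only [sub_eq_add_neg] using h.add h'.neg

theorem comp {F : G → E} (h : PolyBounded F) (φ : G' → G) {B : ℝ}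
    (hφ : ∀ n, ‖φ n‖ ≤ B * (1 + ‖n‖)) : PolyBounded fun n => F (φ n) := by
  obtain ⟨C, M, hC, h⟩ := h
  have hB : 0 ≤ B := by
    have := (norm_nonneg _).trans (hφ 0)
    have h1 : 0 < 1 + ‖(0 : G')‖ := by positivity
    exact nonneg_of_mul_nonneg_left this h1
  refine ⟨C * (1 + B) ^ M, M, by positivity, fun n => (h _).trans ?_⟩
  rw [mul_assoc, ← mul_pow]
  have := hφ n
  have := norm_nonneg n
  gcongr
  nlinarith

theorem comp_sub_right {F : G → E} (h : PolyBounded F) (g : G) :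
    PolyBounded fun n => F (n - g) :=
  h.comp (fun n => n - g) (B := 1 + ‖g‖) fun n => by
    nlinarith [norm_sub_le n g, norm_nonneg n, norm_nonneg g, mul_nonneg (norm_nonneg n) (norm_nonneg g)]

/-- A function on `ℤ × G` supported in a finite range of the first variable has polynomial growth
as soon as all its slices have. -/
theorem of_slices {F : ℤ → G → E} (a b : ℤ) (ha : ∀ p < a, ∀ n, F p n = 0)
    (hb : ∀ p ≥ b, ∀ n, F p n = 0) (h : ∀ p, PolyBounded (F p)) :
    PolyBounded fun q : ℤ × G => F q.1 q.2 := by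
  choose C M hC h using h
  refine ⟨∑ p ∈ Finset.Ico a b, C p, ∑ p ∈ Finset.Ico a b, M p,
    Finset.sum_nonneg fun p _ => hC p, fun ⟨p, n⟩ => ?_⟩
  have h0 : 0 ≤ ∑ p ∈ Finset.Ico a b, C p := Finset.sum_nonneg fun p _ => hC p
  by_cases hp : p ∈ Finset.Ico a b
  · refine (h p n).trans ?_
    have h1 : (1 : ℝ) ≤ 1 + ‖n‖ := by linarith [norm_nonneg n]
    calc C p * (1 + ‖n‖) ^ M p ≤ (∑ p ∈ Finset.Ico a b, C p) * (1 + ‖n‖) ^ M p := by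
          gcongr
          exact Finset.single_le_sum (f := C) (fun p _ => hC p) hp
      _ ≤ (∑ p ∈ Finset.Ico a b, C p) * (1 + ‖n‖) ^ ∑ p ∈ Finset.Ico a b, M p := by
          refine mul_le_mul_of_nonneg_left (pow_le_pow_right₀ h1 ?_) h0
          exact Finset.single_le_sum (f := M) (fun p _ => Nat.zero_le _) hp
      _ ≤ _ := by
          gcongr
          exact norm_snd_le (p, n)
  · rw [Finset.mem_Ico, not_and_or, not_le, not_lt] at hp
    have : F p n = 0 := hp.elim (fun h => ha p h n) (fun h => hb p h n)
    simp only [this, norm_zero]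
    positivity

end PolyBounded

/-! ### Division by `z - w` -/

section MulSub

variable {G M M' : Type*} [AddCommGroup M] [AddCommGroup M']

/-- Multiplication of a formal series in `z` and further variables (indexed by `ℤ` and by the
group `G`) by `z - w ^ g`. -/
def mulSub [AddCommGroup G] (g : G) (F : ℤ → G → M) : ℤ → G → M :=
  fun p n => F (p - 1) n - F p (n - g)

/-- Multiplication by `∏ (z - w ^ g)`, the product running over a list of exponents `g`. -/
def mulSubs [AddCommGroup G] (gs : List G) (F : ℤ → G → M) : ℤ → G → M := gs.foldr mulSub F

section
variable [AddCommGroup G]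

theorem mulSub_comm (g h : G) (F : ℤ → G → M) : mulSub g (mulSub h F) = mulSub h (mulSub g F) := by
  funext p n
  simp only [mulSub, sub_right_comm n h g]
  abel

theorem mulSub_map (φ : M →+ M') (g : G) (F : ℤ → G → M) :
    mulSub g (fun p n => φ (F p n)) = fun p n => φ (mulSub g F p n) := by
  funext p n
  simp only [mulSub, map_sub]

theorem mulSubs_map (φ : M →+ M') (gs : List G) (F : ℤ → G → M) :
    mulSubs gs (fun p n => φ (F p n)) = fun p n => φ (mulSubs gs F p n) := by
  induction gs with
  | nil => rfl
  | cons g gs ih =>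
    simp only [mulSubs, List.foldr_cons] at ih ⊢
    rw [ih, mulSub_map]

theorem mulSubs_add (gs : List G) (F F' : ℤ → G → M) :
    mulSubs gs (F + F') = mulSubs gs F + mulSubs gs F' := by
  induction gs with
  | nil => rfl
  | cons g gs ih =>
    simp only [mulSubs, List.foldr_cons] at ih ⊢
    rw [ih]
    funext p n
    simp only [mulSub, Pi.add_apply]
    abel

theorem mulSubs_zero (gs : List G) : mulSubs gs (0 : ℤ → G → M) = 0 := by
  have h := mulSubs_add gs (0 : ℤ → G → M) 0
  rwa [add_zero, left_eq_add] at h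

theorem mulSubs_append (gs hs : List G) (F : ℤ → G → M) :
    mulSubs (gs ++ hs) F = mulSubs gs (mulSubs hs F) := List.foldr_append

theorem mulSub_mulSubs (g : G) (gs : List G) (F : ℤ → G → M) :
    mulSub g (mulSubs gs F) = mulSubs gs (mulSub g F) := by
  induction gs with
  | nil => rfl
  | cons h gs ih =>
    change mulSub g (mulSub h (mulSubs gs F)) = mulSub h (mulSubs gs (mulSub g F))
    rw [mulSub_comm, ih]

theorem mulSubs_comm (gs hs : List G) (F : ℤ → G → M) :
    mulSubs gs (mulSubs hs F) = mulSubs hs (mulSubs gs F) := by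
  induction gs with
  | nil => rfl
  | cons g gs ih =>
    change mulSub g (mulSubs gs (mulSubs hs F)) = mulSubs hs (mulSub g (mulSubs gs F))
    rw [ih, mulSub_mulSubs]

theorem mulSubs_eq_zero_of_le (gs : List G) {F : ℤ → G → M} {K : ℤ}
    (h : ∀ p ≥ K, ∀ n, F p n = 0) : ∀ p ≥ K + gs.length, ∀ n, mulSubs gs F p n = 0 := by
  induction gs with
  | nil => simpa [mulSubs] using h
  | cons g gs ih =>
    intro p hp n
    rw [List.length_cons, Nat.cast_succ] at hp
    change mulSubs gs F (p - 1) n - mulSubs gs F p (n - g) = 0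
    rw [ih _ (by omega), ih _ (by omega), sub_zero]

theorem mulSubs_eq_zero_of_lt (gs : List G) {F : ℤ → G → M} {K : ℤ}
    (h : ∀ p < K, ∀ n, F p n = 0) : ∀ p < K, ∀ n, mulSubs gs F p n = 0 := by
  induction gs with
  | nil => simpa [mulSubs] using h
  | cons g gs ih =>
    intro p hp n
    change mulSubs gs F (p - 1) n - mulSubs gs F p (n - g) = 0
    rw [ih _ (by omega), ih _ (by omega), sub_zero]

end

variable {E : Type*} [SeminormedAddCommGroup G] [SeminormedAddCommGroup E]

theorem PolyBounded.mulSubs_slice (gs : List G) {F : ℤ → G → E} (h : ∀ p, PolyBounded (F p)) :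
    ∀ p, PolyBounded (mulSubs gs F p) := by
  induction gs with
  | nil => exact h
  | cons g gs ih => exact fun p => (ih (p - 1)).sub ((ih p).comp_sub_right g)

/-- Division by `z - w ^ g`, expanded in the region `|w ^ g| < |z|`, preserves polynomial growth. -/
theorem PolyBounded.of_mulSub {g : G} {F : ℤ → G → E} {K : ℤ} (hK : ∀ p ≥ K, ∀ n, F p n = 0)
    (h : PolyBounded fun q : ℤ × G => mulSub g F q.1 q.2) :
    PolyBounded fun q : ℤ × G => F q.1 q.2 := by
  obtain ⟨C, M, hC, h⟩ := h
  -- the recursion `F (p - 1) n = mulSub g F p n + F p (n - g)` starts from `F K = 0`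
  have key : ∀ (t : ℕ) (n : G),
      ‖F (K - t) n‖ ≤ t * C * (1 + |(K : ℝ)| + t + ‖n‖ + t * ‖g‖) ^ M := by
    intro t
    induction t with
    | zero => intro n; simp [hK K le_rfl]
    | succ t ih =>
      intro n
      have h1 : F (K - (t + 1 : ℕ)) n = mulSub g F (K - t) n + F (K - t) (n - g) := by
        simp only [mulSub, sub_add_cancel]
        congr 1
        push_cast
        ring
      have h2 := h (K - t, n)
      have h3 : ‖((K - t, n) : ℤ × G)‖ ≤ |(K : ℝ)| + t + ‖n‖ := by
        rw [Prod.norm_def, max_le_iff]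
        constructor
        · refine (norm_sub_le _ _).trans ?_
          simp only [Int.norm_eq_abs, Int.cast_natCast, Nat.abs_cast]
          linarith [norm_nonneg n]
        · have := abs_nonneg (K : ℝ)
          have : (0 : ℝ) ≤ t := by positivity
          linarith
      have h4 := norm_sub_le n g
      rw [h1]
      calc ‖mulSub g F (K - t) n + F (K - t) (n - g)‖
          ≤ C * (1 + ‖((K - t, n) : ℤ × G)‖) ^ M
            + t * C * (1 + |(K : ℝ)| + t + ‖n - g‖ + t * ‖g‖) ^ M :=
            (norm_add_le _ _).trans (add_le_add h2 (ih _))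
        _ ≤ C * (1 + |(K : ℝ)| + (t + 1 : ℕ) + ‖n‖ + (t + 1 : ℕ) * ‖g‖) ^ M
            + t * C * (1 + |(K : ℝ)| + (t + 1 : ℕ) + ‖n‖ + (t + 1 : ℕ) * ‖g‖) ^ M := by
            have : 0 ≤ (t + 1) * ‖g‖ := by positivity
            push_cast
            gcongr C * ?_ ^ M + _ * ?_ ^ M <;> linarith
        _ = _ := by push_cast; ring
  set B : ℝ := 1 + 2 * |(K : ℝ)| + 2 + |(K : ℝ)| * ‖g‖ + ‖g‖ with hB
  have hB0 : 0 ≤ B := by positivity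
  refine ⟨C * B ^ (M + 1), M + 1, by positivity, fun ⟨p, n⟩ => ?_⟩
  set r := ‖((p, n) : ℤ × G)‖ with hr
  have hr0 : 0 ≤ r := norm_nonneg _
  have hp : |(p : ℝ)| ≤ r := norm_fst_le (p, n)
  have hn : ‖n‖ ≤ r := norm_snd_le (p, n)
  rcases le_or_gt K p with hpK | hpK
  · simp only [hK p hpK, norm_zero]; positivity
  · obtain ⟨t, ht⟩ := Int.eq_ofNat_of_zero_le (sub_nonneg.2 hpK.le)
    have hpt : p = K - t := by omega
    have htr : (t : ℝ) ≤ |(K : ℝ)| + r := by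
      have h1 : (t : ℝ) = K - p := by rw [hpt]; push_cast; ring
      rw [h1]
      linarith [le_abs_self (K : ℝ), neg_abs_le (p : ℝ)]
    have hk := key t n
    rw [← hpt] at hk
    refine hk.trans ?_
    have hKa := abs_nonneg (K : ℝ)
    have hg := norm_nonneg g
    have e1 : (t : ℝ) ≤ B * (1 + r) := by
      have : 0 ≤ |(K : ℝ)| * ‖g‖ := by positivity
      nlinarith
    have e2 : 1 + |(K : ℝ)| + t + ‖n‖ + t * ‖g‖ ≤ B * (1 + r) := by
      have : t * ‖g‖ ≤ (|(K : ℝ)| + r) * ‖g‖ := by gcongr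
      have : 0 ≤ |(K : ℝ)| * r := by positivity
      have : 0 ≤ |(K : ℝ)| * ‖g‖ * r := by positivity
      nlinarith
    calc t * C * (1 + |(K : ℝ)| + t + ‖n‖ + t * ‖g‖) ^ M
        ≤ (B * (1 + r)) * C * (B * (1 + r)) ^ M := by gcongr
      _ = C * B ^ (M + 1) * (1 + r) ^ (M + 1) := by rw [mul_pow]; ring

theorem PolyBounded.of_mulSubs {gs : List G} {F : ℤ → G → E} {K : ℤ}
    (hK : ∀ p ≥ K, ∀ n, F p n = 0) (h : PolyBounded fun q : ℤ × G => mulSubs gs F q.1 q.2) :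
    PolyBounded fun q : ℤ × G => F q.1 q.2 := by
  induction gs with
  | nil => exact h
  | cons g gs ih => exact ih (.of_mulSub (mulSubs_eq_zero_of_le gs hK) h)

end MulSub

/-! ### Degree-shifted fields of a Möbius vertex algebra -/

namespace MoebiusVertexAlgebra

variable {V : Type*} [AddCommGroup V] [Module ℂ V] (A : MoebiusVertexAlgebra V)

/-- The operator `v_{-p}`, which raises the degree by `p`. For `v ∈ V(d)`, these are the
coefficients of `z ^ d Y(v, z)`; so they are indexed by the exponent of the formal variable. -/
def raise (v : V) (p : ℤ) : Module.End ℂ V := A.shiftedMode (-p) v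

theorem raise_of_mem {d : ℕ} {v : V} (hv : v ∈ A.wt d) (p : ℤ) : A.raise v p = A.Y v (p - d) := by
  rw [raise, shiftedMode, A.linExt_apply _ hv, mode, LinearMap.comp_apply, LinearMap.proj_apply,
    show -(-p + d - 1) - 1 = p - (d : ℤ) by ring]

theorem raise_zero (p : ℤ) : A.raise 0 p = 0 := map_zero _

theorem raise_add (v w : V) (p : ℤ) : A.raise (v + w) p = A.raise v p + A.raise w p := map_add _ _ _

theorem raise_smul (c : ℂ) (v : V) (p : ℤ) : A.raise (c • v) p = c • A.raise v p := map_smul _ _ _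

theorem homogeneous_induction {P : V → Prop} (zero : P 0) (add : ∀ v w, P v → P w → P (v + w))
    (wt : ∀ (d : ℕ), ∀ v ∈ A.wt d, P v) (v : V) : P v :=
  Submodule.iSup_induction A.wt (motive := P)
    (by rw [show ⨆ n, A.wt n = ⊤ from A.isInternal.submodule_iSup_eq_top]; trivial) wt zero add

theorem eq_zero_of_Lzero_eq_smul {c : ℂ} (hc : ∀ n : ℕ, c ≠ n) {v : V} (hv : A.Lzero v = c • v) :
    v = 0 := by
  refine Submodule.disjoint_def.1 (Module.End.eigenspaces_iSupIndep A.Lzero c) _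
    (Module.End.mem_eigenspace_iff.2 hv) ?_
  have hle : (⨆ n : ℕ, Module.End.eigenspace A.Lzero (n : ℂ)) ≤
      ⨆ (μ : ℂ) (_ : μ ≠ c), Module.End.eigenspace A.Lzero μ :=
    iSup_le fun n => le_iSup₂_of_le (n : ℂ) (hc n).symm le_rfl
  exact hle (A.isInternal.submodule_iSup_eq_top ▸ Submodule.mem_top)

theorem Lzero_raise (v : V) {e : ℕ} {u : V} (hu : u ∈ A.wt e) (p : ℤ) :
    A.Lzero (A.raise v p u) = ((e + p : ℤ) : ℂ) • A.raise v p u := by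
  induction v using A.homogeneous_induction with
  | zero => simp [raise]
  | add v w hv hw => rw [raise_add, LinearMap.add_apply, map_add, hv, hw, smul_add]
  | wt d v hv =>
    rw [A.raise_of_mem hv]
    have h := LinearMap.congr_fun (congrFun (A.lie_Lzero v) (p - d)) u
    rw [wt, Module.End.mem_eigenspace_iff] at hv hu
    rw [A.Y_Lneg, hv] at h
    simp only [Ring.lie_def, LinearMap.sub_apply, Module.End.mul_apply, hu, map_smul, Pi.add_apply,
      FormalSeries.zpowMul, FormalSeries.derivative, Pi.smul_apply, LinearMap.add_apply,
      LinearMap.smul_apply, sub_add_cancel, sub_eq_iff_eq_add] at h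
    rw [h, ← Int.cast_smul_eq_zsmul ℂ, ← add_smul, ← add_smul]
    congr 1
    push_cast
    ring

theorem raise_apply_mem (v : V) {e k : ℕ} {u : V} (hu : u ∈ A.wt e) {p : ℤ} (hk : e + p = k) :
    A.raise v p u ∈ A.wt k := by
  rw [wt, Module.End.mem_eigenspace_iff, A.Lzero_raise v hu, hk, Int.cast_natCast]

theorem raise_apply_eq_zero (v : V) {e : ℕ} {u : V} (hu : u ∈ A.wt e) {p : ℤ} (hp : e + p < 0) :
    A.raise v p u = 0 := by
  refine A.eq_zero_of_Lzero_eq_smul (fun n hn => ?_) (A.Lzero_raise v hu p)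
  have : (e + p : ℤ) = n := by exact_mod_cast hn
  omega

/-- The operators `v_{-p}` with `p` very negative annihilate any given vector. -/
theorem exists_raise_apply_eq_zero (v u : V) : ∃ K : ℤ, ∀ p < K, A.raise v p u = 0 := by
  induction u using A.homogeneous_induction with
  | zero => exact ⟨0, fun _ _ => map_zero _⟩
  | add u w hu hw =>
    obtain ⟨K, hK⟩ := hu
    obtain ⟨K', hK'⟩ := hw
    exact ⟨min K K', fun p hp => by
      rw [map_add, hK p (by omega), hK' p (by omega), add_zero]⟩
  | wt e u hu => exact ⟨-e, fun p hp => A.raise_apply_eq_zero v hu (by omega)⟩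

theorem raise_vac {d : ℕ} {v : V} (hv : v ∈ A.wt d) : A.raise v d A.vac = v := by
  rw [A.raise_of_mem hv, sub_self, A.Y_apply_vac_zero]

theorem subMul_add {W : Type*} [AddCommGroup W] (N : ℕ) (B B' : ℤ → ℤ → W) :
    FormalSeries.subMul^[N] (B + B') = FormalSeries.subMul^[N] B + FormalSeries.subMul^[N] B' := by
  induction N generalizing B B' with
  | zero => rfl
  | succ N ih =>
    have : FormalSeries.subMul (B + B') = FormalSeries.subMul B + FormalSeries.subMul B' := by
      funext m n
      simp only [FormalSeries.subMul, Pi.add_apply]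
      abel
    rw [Function.iterate_succ_apply, Function.iterate_succ_apply, Function.iterate_succ_apply,
      this, ih]

theorem subMul_translate {W : Type*} [AddCommGroup W] (N : ℕ) (B : ℤ → ℤ → W) (s t : ℤ) :
    FormalSeries.subMul^[N] (fun m n => B (m - s) (n - t)) =
      fun m n => FormalSeries.subMul^[N] B (m - s) (n - t) := by
  induction N generalizing B with
  | zero => rfl
  | succ N ih =>
    rw [Function.iterate_succ_apply, Function.iterate_succ_apply, ← ih]
    congr 1
    funext m n
    simp only [FormalSeries.subMul, sub_right_comm]

/-- Locality of the degree-shifted fields. -/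
theorem raise_locality (v u : V) :
    ∃ N₀ : ℕ, ∀ N ≥ N₀, FormalSeries.subMul^[N] (fun m n => ⁅A.raise v m, A.raise u n⁆) = 0 := by
  have h0 (N : ℕ) : FormalSeries.subMul^[N] (0 : ℤ → ℤ → Module.End ℂ V) = 0 := by
    have h := subMul_add N (0 : ℤ → ℤ → Module.End ℂ V) 0
    rwa [add_zero, left_eq_add] at h
  induction v using A.homogeneous_induction with
  | zero => exact ⟨0, fun N _ => by
      simp only [raise_zero, Ring.lie_def, zero_mul, mul_zero, sub_zero]
      exact h0 N⟩
  | add v w hv hw =>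
    obtain ⟨K, hK⟩ := hv
    obtain ⟨K', hK'⟩ := hw
    refine ⟨max K K', fun N hN => ?_⟩
    have := subMul_add N (fun m n => ⁅A.raise v m, A.raise u n⁆) fun m n => ⁅A.raise w m, A.raise u n⁆
    rw [hK N (le_of_max_le_left hN), hK' N (le_of_max_le_right hN), add_zero] at this
    rw [← this]
    congr 1
    funext m n
    simp only [raise_add, Ring.lie_def, add_mul, mul_add, Pi.add_apply]
    abel
  | wt d v hv =>
    induction u using A.homogeneous_induction with
    | zero => exact ⟨0, fun N _ => by
      simp only [raise_zero, Ring.lie_def, zero_mul, mul_zero, sub_zero]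
      exact h0 N⟩
    | add u w hu hw =>
      obtain ⟨K, hK⟩ := hu
      obtain ⟨K', hK'⟩ := hw
      refine ⟨max K K', fun N hN => ?_⟩
      have := subMul_add N (fun m n => ⁅A.raise v m, A.raise u n⁆)
        fun m n => ⁅A.raise v m, A.raise w n⁆
      rw [hK N (le_of_max_le_left hN), hK' N (le_of_max_le_right hN), add_zero] at this
      rw [← this]
      congr 1
      funext m n
      simp only [raise_add, Ring.lie_def, add_mul, mul_add, Pi.add_apply]
      abel
    | wt e u hu =>
      obtain ⟨N₀, hN₀⟩ := A.locality v u
      refine ⟨N₀, fun N hN => ?_⟩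
      simp only [A.raise_of_mem hv, A.raise_of_mem hu]
      rw [subMul_translate N (fun m n => ⁅A.Y v m, A.Y u n⁆), hN₀ N hN]
      rfl

theorem Lone_pow_mem {d j : ℕ} (hj : j ≤ d) {v : V} (hv : v ∈ A.wt d) :
    (A.Lone ^ j) v ∈ A.wt (d - j) := by
  induction j with
  | zero => simpa using hv
  | succ j ih =>
    rw [pow_succ', Module.End.mul_apply]
    exact A.Lone_mem (by rw [show d - (j + 1) + 1 = d - j by omega]; exact ih (by omega))

theorem raise_sum {ι : Type*} (s : Finset ι) (v : ι → V) (p : ℤ) :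
    A.raise (∑ i ∈ s, v i) p = ∑ i ∈ s, A.raise (v i) p := map_sum _ _ _

theorem expLone_negOnePowLzero_of_mem {d : ℕ} {v : V} (hv : v ∈ A.wt d) :
    A.expLone (A.negOnePowLzero v) =
      ∑ j ∈ Finset.range (d + 1), ((-1 : ℂ) ^ d * (j.factorial : ℂ)⁻¹) • (A.Lone ^ j) v := by
  rw [negOnePowLzero, A.linExt_apply _ hv, LinearMap.smul_apply, LinearMap.id_apply, map_smul,
    expLone, A.linExt_apply _ hv, LinearMap.sum_apply, Finset.smul_sum]
  simp only [LinearMap.smul_apply, smul_smul]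

/-- Invariance of a bilinear form, in terms of the degree-shifted fields. -/
theorem IsInvariantForm.raise {B : V →ₗ[ℂ] V →ₗ[ℂ] ℂ} (hB : A.IsInvariantForm B) (v u u' : V)
    (p : ℤ) :
    B (A.raise v p u) u' = B u (A.raise (A.expLone (A.negOnePowLzero v)) (-p) u') := by
  induction v using A.homogeneous_induction with
  | zero => simp [MoebiusVertexAlgebra.raise]
  | add v w hv hw => simp only [map_add, raise_add, LinearMap.add_apply, hv, hw]
  | wt d v hv =>
    rw [A.raise_of_mem hv, hB d v hv, A.expLone_negOnePowLzero_of_mem hv, raise_sum,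
      LinearMap.sum_apply]
    congr 1
    refine Finset.sum_congr rfl fun j hj => ?_
    rw [Finset.mem_range, Nat.lt_succ_iff] at hj
    rw [raise_smul, A.raise_of_mem (A.Lone_pow_mem hj hv), LinearMap.smul_apply, Nat.cast_sub hj,
      show -p - ((d : ℤ) - j) = j - 2 * d - (p - d) by ring]

end MoebiusVertexAlgebra

namespace UnitaryMoebiusVertexAlgebra

variable {V : Type*} [NormedAddCommGroup V] [InnerProductSpace ℂ V]
  (A : UnitaryMoebiusVertexAlgebra V)

theorem Θ_mem {d : ℕ} {v : V} (hv : v ∈ A.wt d) : A.Θ v ∈ A.wt d := by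
  rw [MoebiusVertexAlgebra.wt, Module.End.mem_eigenspace_iff] at hv ⊢
  rw [← A.isAntilinearAutomorphism.map_Lzero, hv, LinearEquiv.map_smulₛₗ, map_natCast]

theorem Θ_Lone_pow (j : ℕ) (v : V) : A.Θ ((A.Lone ^ j) v) = (A.Lone ^ j) (A.Θ v) := by
  induction j with
  | zero => rfl
  | succ j ih =>
    rw [pow_succ', Module.End.mul_apply, Module.End.mul_apply, A.isAntilinearAutomorphism.map_Lone,
      ih]

theorem Θ_expLone_negOnePowLzero (v : V) : A.Θ (A.expLone (A.negOnePowLzero v)) = A.tilde v := by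
  rw [tilde]
  induction v using A.homogeneous_induction with
  | zero => simp
  | add v w hv hw => simp only [map_add, hv, hw]
  | wt d v hv =>
    rw [A.expLone_negOnePowLzero_of_mem hv, A.expLone_negOnePowLzero_of_mem (A.Θ_mem hv), map_sum]
    refine Finset.sum_congr rfl fun j _ => ?_
    rw [LinearEquiv.map_smulₛₗ, Θ_Lone_pow]
    simp

theorem Θ_raise (v u : V) (p : ℤ) : A.Θ (A.raise v p u) = A.raise (A.Θ v) p (A.Θ u) := by
  induction v using A.homogeneous_induction with
  | zero => simp [MoebiusVertexAlgebra.raise]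
  | add v w hv hw => simp only [MoebiusVertexAlgebra.raise_add, LinearMap.add_apply, map_add, hv, hw]
  | wt d v hv =>
    rw [A.raise_of_mem hv, A.raise_of_mem (A.Θ_mem hv)]
    have h := A.isAntilinearAutomorphism.map_mode v u (-(p - d) - 1)
    simpa [MoebiusVertexAlgebra.mode] using h

/-- On `V`, the operators `v_n` and `(tilde v)_{-n}` are adjoint to each other. -/
theorem inner_raise_left (v u u' : V) (p : ℤ) :
    inner ℂ (A.raise v p u) u' = inner ℂ u (A.raise (A.tilde v) (-p) u') := by
  obtain ⟨w, rfl⟩ := A.Θ.surjective u'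
  have h := A.invariant.raise A.toMoebiusVertexAlgebra v u w p
  simp only [thetaForm, LinearMap.mk₂_apply, ip, Θ_raise, Θ_expLone_negOnePowLzero] at h
  rw [← inner_conj_symm, h, inner_conj_symm]

theorem inner_eq_zero_of_wt {d e : ℕ} (hde : d ≠ e) {u w : V} (hu : u ∈ A.wt d)
    (hw : w ∈ A.wt e) : inner ℂ u w = 0 := by
  have h := A.ip_Lzero u w
  rw [MoebiusVertexAlgebra.wt, Module.End.mem_eigenspace_iff] at hu hw
  simp only [ip, hu, hw, inner_smul_left, inner_smul_right, map_natCast] at h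
  have h2 : inner ℂ w u = 0 := by
    by_contra h0
    exact hde (by exact_mod_cast mul_right_cancel₀ h0 h)
  rw [← inner_conj_symm, h2, map_zero]

end UnitaryMoebiusVertexAlgebra

/-! ### Products of fields -/

namespace MoebiusVertexAlgebra

variable {V : Type*} [AddCommGroup V] [Module ℂ V] (A : MoebiusVertexAlgebra V)

/-- The families of coefficients of a product of `k` degree-shifted fields in `k` independent
formal variables. The family is indexed by `ℤ × (ℤ × ⋯)`. -/
inductive FieldProduct : {G : Type} → [SeminormedAddCommGroup G] → (G → Module.End ℂ V) → Prop
  | one : FieldProduct (G := PUnit) fun _ => 1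
  | mul {G : Type} [SeminormedAddCommGroup G] (v : V) {T : G → Module.End ℂ V}
      (hT : FieldProduct T) : FieldProduct fun q : ℤ × G => A.raise v q.1 * T q.2

theorem mulSubs_replicate {G : Type} [AddCommGroup G] (N : ℕ) (B : ℤ → ℤ → Module.End ℂ V)
    (T : G → Module.End ℂ V) :
    mulSubs (List.replicate N ((1 : ℤ), (0 : G))) (fun p q => B p q.1 * T q.2) =
      fun p q => FormalSeries.subMul^[N] B p q.1 * T q.2 := by
  induction N with
  | zero => rfl
  | succ N ih =>
    rw [List.replicate_succ]
    change mulSub _ (mulSubs _ _) = _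
    rw [ih, Function.iterate_succ_apply']
    funext p q
    simp only [mulSub, FormalSeries.subMul, Prod.fst_sub, Prod.snd_sub, sub_zero, sub_mul]

theorem mulSubs_map_snd {G : Type} [AddCommGroup G] (gs : List G) (X : ℤ → Module.End ℂ V)
    (F : ℤ → G → Module.End ℂ V) :
    mulSubs (gs.map fun g => ((0 : ℤ), g)) (fun p q => X q.1 * F p q.2) =
      fun p q => X q.1 * mulSubs gs F p q.2 := by
  induction gs with
  | nil => rfl
  | cons g gs ih =>
    change mulSub _ (mulSubs _ _) = _
    rw [ih]
    funext p q
    change _ = X q.1 * mulSub g (mulSubs gs F) p q.2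
    simp only [mulSub, Prod.fst_sub, Prod.snd_sub, sub_zero, mul_sub]

variable {A}

/-- Locality of a field with a product of fields: a product of factors `z - w_j` annihilates the
commutator. -/
theorem FieldProduct.locality {G : Type} [SeminormedAddCommGroup G] {T : G → Module.End ℂ V}
    (hT : A.FieldProduct T) (v : V) :
    ∃ gs : List G, mulSubs gs (fun p n => ⁅A.raise v p, T n⁆) = 0 := by
  induction hT with
  | one => exact ⟨[], by
      simp only [Ring.lie_def, mul_one, one_mul, sub_self]
      rfl⟩
  | @mul G _ u T hT ih =>
    obtain ⟨gs, hgs⟩ := ih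
    obtain ⟨N, hN⟩ := A.raise_locality v u
    -- the Leibniz rule for the commutator with a product
    have h : (fun (p : ℤ) (q : ℤ × G) => ⁅A.raise v p, A.raise u q.1 * T q.2⁆) =
        (fun p q => ⁅A.raise v p, A.raise u q.1⁆ * T q.2) +
          fun p q => A.raise u q.1 * ⁅A.raise v p, T q.2⁆ := by
      funext p q
      simp only [Pi.add_apply, Ring.lie_def, sub_mul, mul_sub, mul_assoc]
      abel
    refine ⟨List.replicate N (1, 0) ++ gs.map fun g => (0, g), ?_⟩
    have h1 := mulSubs_replicate N (fun m n => ⁅A.raise v m, A.raise u n⁆) T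
    have h2 := mulSubs_map_snd gs (A.raise u) fun p n => ⁅A.raise v p, T n⁆
    rw [hN N le_rfl] at h1
    rw [hgs] at h2
    simp only [Pi.zero_apply, zero_mul, mul_zero] at h1 h2
    have z : (fun _ _ => 0 : ℤ → ℤ × G → Module.End ℂ V) = 0 := rfl
    rw [h, mulSubs_add, mulSubs_append, mulSubs_append, h2,
      mulSubs_comm (List.replicate N ((1 : ℤ), (0 : G))), h1, z, mulSubs_zero, mulSubs_zero, add_zero]

/-- The matrix coefficients of a product of fields grow polynomially: after multiplication by a
product of factors `z - w_j`, the variable `z` of the leftmost field occurs with finitely many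
exponents only. -/
theorem FieldProduct.polyBounded_coeff {G : Type} [SeminormedAddCommGroup G]
    {T : G → Module.End ℂ V} (hT : A.FieldProduct T) (l : V →ₗ[ℂ] ℂ) (K : ℕ)
    (hl : ∀ d ≥ K, ∀ x ∈ A.wt d, l x = 0) (u : V) : PolyBounded fun n => l (T n u) := by
  induction hT generalizing l K with
  | one => exact .const _
  | @mul G _ v T hT ih =>
    obtain ⟨gs, hgs⟩ := hT.locality v
    obtain ⟨a, ha⟩ := A.exists_raise_apply_eq_zero v u
    set F : ℤ → G → ℂ := fun p n => l (A.raise v p (T n u)) with hF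
    -- a large exponent of `z` leads to a degree on which `l` vanishes
    have hFK : ∀ p ≥ (K : ℤ), ∀ n, F p n = 0 := by
      intro p hp n
      simp only [hF]
      generalize T n u = x
      induction x using A.homogeneous_induction with
      | zero => simp
      | add x y hx hy => simp only [map_add, hx, hy, add_zero]
      | wt e x hx =>
        obtain ⟨k, hk⟩ := Int.eq_ofNat_of_zero_le (show 0 ≤ e + p by omega)
        exact hl k (by omega) _ (A.raise_apply_mem v hx hk)
    -- for a fixed exponent of `z`, the leftmost operator can be absorbed into the functional
    have hslice : ∀ p, PolyBounded (F p) := by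
      intro p
      refine ih (l ∘ₗ A.raise v p) (K + p.natAbs) fun d hd x hx => ?_
      obtain ⟨k, hk⟩ := Int.eq_ofNat_of_zero_le (show 0 ≤ d + p by omega)
      exact hl k (by omega) _ (A.raise_apply_mem v hx hk)
    -- locality: the field `v` may be moved to the right of the product
    have hswap : mulSubs gs F = mulSubs gs fun p n => l (T n (A.raise v p u)) := by
      have h1 : F = (fun p n => l (T n (A.raise v p u))) +
          fun p n => (l ∘ₗ LinearMap.applyₗ u).toAddMonoidHom ⁅A.raise v p, T n⁆ := by
        funext p n
        simp [hF, Ring.lie_def]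
      rw [h1, mulSubs_add, mulSubs_map, hgs]
      funext p n
      simp
    refine PolyBounded.of_mulSubs hFK (gs := gs) (.of_slices a (K + gs.length) ?_
      (mulSubs_eq_zero_of_le gs hFK) (PolyBounded.mulSubs_slice gs hslice))
    rw [hswap]
    exact mulSubs_eq_zero_of_lt gs fun p hp n => by rw [ha p hp, map_zero, map_zero]

end MoebiusVertexAlgebra

namespace UnitaryMoebiusVertexAlgebra

open MoebiusVertexAlgebra

variable {V : Type*} [NormedAddCommGroup V] [InnerProductSpace ℂ V]
  {A : UnitaryMoebiusVertexAlgebra V}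

/-- A vector of `V` is orthogonal to all vectors of sufficiently high degree. -/
theorem exists_inner_eq_zero (u : V) :
    ∃ K : ℕ, ∀ d ≥ K, ∀ x ∈ A.wt d, inner ℂ u x = 0 := by
  induction u using A.homogeneous_induction with
  | zero => exact ⟨0, fun _ _ _ _ => inner_zero_left _⟩
  | add u w hu hw =>
    obtain ⟨K, hK⟩ := hu
    obtain ⟨K', hK'⟩ := hw
    exact ⟨max K K', fun d hd x hx => by
      rw [inner_add_left, hK d (le_of_max_le_left hd) x hx, hK' d (le_of_max_le_right hd) x hx,
        add_zero]⟩
  | wt e u hu => exact ⟨e + 1, fun d hd x hx => A.inner_eq_zero_of_wt (by omega) hu hx⟩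

/-- Inner products of vectors obtained from two products of fields grow polynomially: the first
product can be moved to the other side, field by field. -/
theorem polyBounded_inner {G G' : Type} [SeminormedAddCommGroup G] [SeminormedAddCommGroup G']
    {T : G → Module.End ℂ V} (hT : A.FieldProduct T) {T' : G' → Module.End ℂ V}
    (hT' : A.FieldProduct T') (u u' : V) :
    PolyBounded fun q : G × G' => (inner ℂ (T q.1 u) (T' q.2 u') : ℂ) := by
  induction hT generalizing G' with
  | one =>
    obtain ⟨K, hK⟩ := A.exists_inner_eq_zero u
    exact (hT'.polyBounded_coeff (innerₛₗ ℂ u) K hK u').comp (G' := PUnit × G') Prod.snd (B := 1)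
      fun n => by linarith [norm_snd_le n]
  | @mul G _ v T hT ih =>
    -- the leftmost field moves to the other side of the inner product
    refine ((ih (.mul (A.tilde v) hT')).comp (G' := (ℤ × G) × G')
      (fun q => (q.1.2, (-q.1.1, q.2))) (B := 1) fun q => ?_).mono fun q => ?_
    · simp only [Prod.norm_def, norm_neg, one_mul]
      have := norm_nonneg q.1.1
      grind
    · simp only [Module.End.mul_apply, A.inner_raise_left, le_refl]

/-- The norms of the vectors obtained from a fixed vector by a product of fields grow
polynomially. -/
theorem polyBounded_apply {G : Type} [SeminormedAddCommGroup G] {T : G → Module.End ℂ V}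
    (hT : A.FieldProduct T) (u : V) : PolyBounded fun n => T n u := by
  obtain ⟨C, M, hC, h⟩ := (polyBounded_inner hT hT u u).comp (fun n : G => (n, n)) (B := 1)
    fun n => by simp [Prod.norm_def]
  refine ⟨C + 1, M, by positivity, fun n => ?_⟩
  have h1 := h n
  have h2 : (1 : ℝ) ≤ (1 + ‖n‖) ^ M := one_le_pow₀ (by linarith [norm_nonneg n])
  simp only [inner_self_eq_norm_sq_to_K, norm_pow, RCLike.norm_ofReal, abs_norm] at h1
  have h3 : ‖T n u‖ ≤ ‖T n u‖ ^ 2 + 1 := by nlinarith [sq_nonneg (‖T n u‖ - 1)]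
  nlinarith

end UnitaryMoebiusVertexAlgebra

/-! ### Fourier coefficients of test functions -/

namespace TestFn

theorem fourier_smul (c : ℂ) (f : TestFn) (n : ℤ) : (c • f).fourier n = c * f.fourier n := by
  simp only [fourier, lift_smul, Pi.smul_apply, smul_eq_mul, mul_assoc]
  rw [intervalIntegral.integral_const_mul]
  ring

theorem fourier_conj (f : TestFn) (n : ℤ) : f.conj.fourier (-n) = starRingEnd ℂ (f.fourier n) := by
  rw [fourier, fourier, map_mul, ← intervalIntegral.intervalIntegral_conj]
  congr 1
  · rw [map_inv₀, map_mul, Complex.conj_ofReal, map_ofNat]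
  · refine intervalIntegral.integral_congr fun θ _ => ?_
    simp only [lift, conj, map_mul, ← Complex.exp_conj]
    congr 2
    simp

theorem norm_exp_neg_I_mul (n : ℤ) (θ : ℝ) : ‖Complex.exp (-(Complex.I * n * θ))‖ = 1 := by
  rw [Complex.norm_exp]
  simp

theorem periodic_iteratedDeriv_lift (f : TestFn) (k : ℕ) :
    Function.Periodic (iteratedDeriv k f.lift) (2 * Real.pi) := fun θ => by
  have h := congrFun (iteratedDeriv_comp_add_const k f.lift (2 * Real.pi)) θ
  rw [← h, funext f.periodic_lift]

theorem continuous_iteratedDeriv_lift (f : TestFn) (k : ℕ) :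
    Continuous (iteratedDeriv k f.lift) :=
  f.contDiff_lift.continuous_iteratedDeriv k (by exact_mod_cast le_top)

/-- Integration by parts: differentiation multiplies the `n`-th Fourier coefficient by `i n`. -/
theorem integral_iteratedDeriv (f : TestFn) (k : ℕ) (n : ℤ) :
    (2 * Real.pi : ℂ)⁻¹ * ∫ θ in (0 : ℝ)..(2 * Real.pi),
      iteratedDeriv k f.lift θ * Complex.exp (-(Complex.I * n * θ)) =
      (Complex.I * n) ^ k * f.fourier n := by
  induction k with
  | zero => simp [fourier]
  | succ k ih =>
    have hu (θ : ℝ) : HasDerivAt (iteratedDeriv k f.lift) (iteratedDeriv (k + 1) f.lift θ) θ := by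
      rw [iteratedDeriv_succ]
      exact (f.contDiff_lift.differentiable_iteratedDeriv k
        (by exact_mod_cast WithTop.coe_lt_top _) θ).hasDerivAt
    have hv (θ : ℝ) : HasDerivAt (fun θ : ℝ => Complex.exp (-(Complex.I * n * θ)))
        (-(Complex.I * n) * Complex.exp (-(Complex.I * n * θ))) θ := by
      have h1 : HasDerivAt (fun θ : ℝ => -(Complex.I * n * (θ : ℂ))) (-(Complex.I * n)) θ := by
        have h2 := ((Complex.ofRealCLM.hasDerivAt (x := θ)).const_mul (Complex.I * n)).neg
        rw [Complex.ofRealCLM_apply, Complex.ofReal_one, mul_one] at h2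
        exact h2
      simpa [mul_comm] using h1.cexp
    have hint : IntervalIntegrable (fun θ : ℝ => -(Complex.I * n) *
        Complex.exp (-(Complex.I * n * θ))) MeasureTheory.volume 0 (2 * Real.pi) := by
      apply Continuous.intervalIntegrable
      fun_prop
    have h := intervalIntegral.integral_mul_deriv_eq_deriv_mul (fun θ _ => hu θ) (fun θ _ => hv θ)
      ((f.continuous_iteratedDeriv_lift (k + 1)).intervalIntegrable 0 (2 * Real.pi)) hint
    have hp : iteratedDeriv k f.lift (2 * Real.pi) = iteratedDeriv k f.lift 0 := by
      simpa using f.periodic_iteratedDeriv_lift k 0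
    have he : Complex.exp (-(Complex.I * n * (2 * Real.pi : ℝ))) =
        Complex.exp (-(Complex.I * n * (0 : ℝ))) := by
      rw [Complex.ofReal_zero, mul_zero, neg_zero, Complex.exp_zero, Complex.exp_eq_one_iff]
      exact ⟨-n, by push_cast; ring⟩
    rw [hp, he, sub_self, zero_sub] at h
    have h2 : ∫ θ in (0 : ℝ)..(2 * Real.pi), iteratedDeriv k f.lift θ *
        (-(Complex.I * n) * Complex.exp (-(Complex.I * n * θ))) = -(Complex.I * n) *
        ∫ θ in (0 : ℝ)..(2 * Real.pi), iteratedDeriv k f.lift θ *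
          Complex.exp (-(Complex.I * n * θ)) := by
      rw [← intervalIntegral.integral_const_mul]
      congr 1
      funext θ
      ring
    rw [h2] at h
    rw [← neg_eq_iff_eq_neg.2 h, pow_succ', mul_assoc (Complex.I * n), ← ih]
    ring

theorem norm_iteratedDeriv_le (f : TestFn) (k : ℕ) (θ : ℝ) :
    ‖iteratedDeriv k f.lift θ‖ ≤ supSeminorm k f :=
  le_ciSup (f.bddAbove_iteratedDeriv k) θ

theorem norm_pow_mul_fourier_le (f : TestFn) (k : ℕ) (n : ℤ) :
    ‖n‖ ^ k * ‖f.fourier n‖ ≤ supSeminorm k f := by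
  have h := f.integral_iteratedDeriv k n
  have h1 : ‖n‖ ^ k * ‖f.fourier n‖ = ‖(Complex.I * n) ^ k * f.fourier n‖ := by
    rw [norm_mul, norm_pow, norm_mul, Complex.norm_I, one_mul, Complex.norm_intCast,
      Int.norm_eq_abs]
  rw [h1, ← h, norm_mul]
  have h2 := intervalIntegral.norm_integral_le_of_norm_le_const (a := 0) (b := 2 * Real.pi)
    (f := fun θ => iteratedDeriv k f.lift θ * Complex.exp (-(Complex.I * n * θ)))
    (C := supSeminorm k f) fun θ _ => by
      rw [norm_mul, norm_exp_neg_I_mul, mul_one]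
      exact f.norm_iteratedDeriv_le k θ
  have h3 : ‖(2 * Real.pi : ℂ)⁻¹‖ = (2 * Real.pi)⁻¹ := by
    rw [norm_inv, norm_mul, Complex.norm_real, Real.norm_of_nonneg Real.pi_pos.le]
    simp
  rw [h3, inv_mul_le_iff₀ Real.two_pi_pos]
  rwa [sub_zero, abs_of_pos Real.two_pi_pos, mul_comm (supSeminorm k f)] at h2

/-- The Fourier coefficients of a test function are rapidly decreasing, with a bound by continuous
seminorms. -/
theorem fourier_mul_pow_le (f : TestFn) (M : ℕ) (n : ℤ) :
    ‖f.fourier n‖ * (1 + ‖n‖) ^ M ≤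
      2 ^ (M + 2) * (supSeminorm 0 f + supSeminorm (M + 2) f) * ((1 + ‖n‖) ^ 2)⁻¹ := by
  have hn := norm_nonneg n
  rw [← div_eq_mul_inv, le_div_iff₀ (by positivity), mul_assoc, ← pow_add]
  have h0 := f.norm_pow_mul_fourier_le 0 n
  have h1 := f.norm_pow_mul_fourier_le (M + 2) n
  have h2 : (1 + ‖n‖) ^ (M + 2) ≤ 2 ^ (M + 2) * (1 + ‖n‖ ^ (M + 2)) := by
    refine (add_pow_le zero_le_one hn (M + 2)).trans ?_
    rw [one_pow]
    gcongr
    · norm_num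
    · omega
  calc ‖f.fourier n‖ * (1 + ‖n‖) ^ (M + 2)
      ≤ ‖f.fourier n‖ * (2 ^ (M + 2) * (1 + ‖n‖ ^ (M + 2))) := by gcongr
    _ = 2 ^ (M + 2) * (‖n‖ ^ 0 * ‖f.fourier n‖ + ‖n‖ ^ (M + 2) * ‖f.fourier n‖) := by ring
    _ ≤ _ := by gcongr

theorem summable_inv_one_add_norm_sq : Summable fun n : ℤ => ((1 + ‖n‖) ^ 2)⁻¹ := by
  have h : Summable fun n : ℕ => ((1 + (n : ℝ)) ^ 2)⁻¹ := by
    have := (summable_nat_add_iff 1).2 (Real.summable_nat_pow_inv (p := 2).2 one_lt_two)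
    simpa [add_comm] using this
  refine Summable.of_nat_of_neg ?_ ?_ <;> simpa [Int.norm_eq_abs] using h

theorem summable_fourier_mul_pow (f : TestFn) (M : ℕ) :
    Summable fun n : ℤ => ‖f.fourier n‖ * (1 + ‖n‖) ^ M :=
  .of_nonneg_of_le (fun _ => by positivity) (f.fourier_mul_pow_le M)
    (summable_inv_one_add_norm_sq.mul_left _)

/-- Smearing a polynomially bounded sequence of vectors is continuous in the test function. -/
theorem continuous_of_hasSum {E : Type*} [NormedAddCommGroup E] [NormedSpace ℂ E] {z : ℤ → E}
    (hz : PolyBounded z) (S : TestFn →ₗ[ℂ] E)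
    (hS : ∀ f : TestFn, HasSum (fun n => f.fourier n • z n) (S f)) : Continuous S := by
  obtain ⟨C, M, hC, hz⟩ := hz
  set Z : ℝ := ∑' n : ℤ, ((1 + ‖n‖) ^ 2)⁻¹ with hZ
  have hZ0 : 0 ≤ Z := tsum_nonneg fun _ => by positivity
  have hbound (f : TestFn) :
      ‖S f‖ ≤ C * 2 ^ (M + 2) * Z * (supSeminorm 0 f + supSeminorm (M + 2) f) := by
    have h1 : ∀ n, ‖f.fourier n • z n‖ ≤
        C * (2 ^ (M + 2) * (supSeminorm 0 f + supSeminorm (M + 2) f)) * ((1 + ‖n‖) ^ 2)⁻¹ := by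
      intro n
      calc ‖f.fourier n • z n‖ ≤ ‖f.fourier n‖ * (C * (1 + ‖n‖) ^ M) := by
            rw [norm_smul]
            gcongr
            exact hz n
        _ = C * (‖f.fourier n‖ * (1 + ‖n‖) ^ M) := by ring
        _ ≤ C * (2 ^ (M + 2) * (supSeminorm 0 f + supSeminorm (M + 2) f) *
              ((1 + ‖n‖) ^ 2)⁻¹) := mul_le_mul_of_nonneg_left (f.fourier_mul_pow_le M n) hC
        _ = _ := by ring
    have h2 := (hS f).norm_le_of_bounded (summable_inv_one_add_norm_sq.hasSum.mul_left _) h1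
    refine h2.trans (le_of_eq ?_)
    ring
  refine withSeminorms.continuous_normedSpace_rng E S
    ⟨{0, M + 2}, (C * 2 ^ (M + 2) * Z).toNNReal * 2, fun f => ?_⟩
  have hm (k : ℕ) (hk : k ∈ ({0, M + 2} : Finset ℕ)) :
      supSeminorm k f ≤ (({0, M + 2} : Finset ℕ).sup supSeminorm) f :=
    Seminorm.le_def.1 (Finset.le_sup hk) f
  have hc : 0 ≤ C * 2 ^ (M + 2) * Z := by positivity
  calc ‖S f‖ ≤ C * 2 ^ (M + 2) * Z * (supSeminorm 0 f + supSeminorm (M + 2) f) := hbound f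
    _ ≤ C * 2 ^ (M + 2) * Z * ((({0, M + 2} : Finset ℕ).sup supSeminorm) f +
          (({0, M + 2} : Finset ℕ).sup supSeminorm) f) := by
        gcongr
        · exact hm 0 (by simp)
        · exact hm (M + 2) (by simp)
    _ = _ := by
        rw [smul_apply, NNReal.smul_def, NNReal.coe_mul, Real.coe_toNNReal _ hc]
        simp only [NNReal.coe_ofNat, smul_eq_mul]
        ring

/-- The test function `z ↦ z ^ (-d)`. -/
def negPow (d : ℕ) : TestFn :=
  conj ⟨fun z => (z : ℂ) ^ d, by
    have h : ContMDiff (𝓡 1) (modelWithCornersSelf ℝ ℂ) ∞ fun z : Circle => (z : ℂ) :=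
      haveI := finrank_real_complex_fact'
      contMDiff_coe_sphere (E := ℂ) (n := 1)
    exact (contDiff_id.pow d).contMDiff.comp h⟩

theorem fourier_negPow (d : ℕ) (n : ℤ) : (negPow d).fourier n = if n = -d then 1 else 0 := by
  have h : ∀ θ : ℝ, (negPow d).lift θ * Complex.exp (-(Complex.I * n * θ)) =
      Complex.exp (-(Complex.I * (n + d)) * θ) := by
    intro θ
    simp only [negPow, lift, conj, Circle.coe_exp, map_pow, ← Complex.exp_conj,
      ← Complex.exp_nat_mul, ← Complex.exp_add]
    congr 1
    simp
    ring
  simp only [fourier, h]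
  have hpi : (2 * Real.pi : ℂ) ≠ 0 := by
    simp [Real.pi_ne_zero]
  split_ifs with hn
  · subst hn
    simp
    field_simp
  · have hc : -(Complex.I * ((n : ℂ) + d)) ≠ 0 := by
      refine neg_ne_zero.2 (mul_ne_zero Complex.I_ne_zero ?_)
      intro h0
      have : n + d = 0 := by exact_mod_cast h0
      omega
    have he : Complex.exp (-(Complex.I * ((n : ℂ) + d)) * (2 * Real.pi : ℝ)) = 1 := by
      rw [Complex.exp_eq_one_iff]
      exact ⟨-(n + d), by push_cast; ring⟩
    rw [integral_exp_mul_complex hc, he]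
    simp

end TestFn

/-! ### Smeared fields -/

namespace UnitaryMoebiusVertexAlgebra

open MoebiusVertexAlgebra

variable {V : Type*} [NormedAddCommGroup V] [InnerProductSpace ℂ V]
  (A : UnitaryMoebiusVertexAlgebra V)

theorem mem_graph_preSmeared_iff_raise (v : V) (f : TestFn) (x y : Hilb V) :
    (x, y) ∈ (A.preSmeared v f).graph ↔ ∃ u : V, (u : Hilb V) = x ∧
      HasSum (fun p : ℤ => f.fourier (-p) • ((A.raise v p u : V) : Hilb V)) y := by
  rw [mem_graph_preSmeared]
  refine exists_congr fun u => and_congr_right fun _ => ?_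
  rw [← (Equiv.neg ℤ).hasSum_iff]
  rfl

theorem exists_mem_graph_preSmeared (v : V) (f : TestFn) (u : V) :
    ∃ y, ((u : Hilb V), y) ∈ (A.preSmeared v f).graph := by
  obtain ⟨C, M, hC, h⟩ := (polyBounded_apply (.mul v .one) u).comp (G' := ℤ)
    (fun p => (-p, PUnit.unit)) (B := 1) fun p => by simp [Prod.norm_def]
  have hs : Summable fun n : ℤ => f.fourier n • ((A.raise v (-n) u : V) : Hilb V) := by
    refine .of_norm_bounded ((f.summable_fourier_mul_pow M).mul_left C) fun n => ?_
    rw [norm_smul, UniformSpace.Completion.norm_coe]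
    calc ‖f.fourier n‖ * ‖A.raise v (-n) u‖ ≤ ‖f.fourier n‖ * (C * (1 + ‖n‖) ^ M) := by
          gcongr
          exact h n
      _ = _ := by ring
  refine ⟨∑' n : ℤ, f.fourier n • ((A.raise v (-n) u : V) : Hilb V),
    (A.mem_graph_preSmeared_iff_raise v f _ _).2 ⟨u, rfl, ?_⟩⟩
  rw [← (Equiv.neg ℤ).hasSum_iff]
  simpa only [Function.comp_def, Equiv.neg_apply, neg_neg] using hs.hasSum

/-- `Y⁰(v, f)` and `Y⁰(tilde v, conj f)` are formally adjoint. -/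
theorem inner_graph_preSmeared (v : V) (f : TestFn) {x y x' y' : Hilb V}
    (h : (x, y) ∈ (A.preSmeared v f).graph)
    (h' : (x', y') ∈ (A.preSmeared (A.tilde v) f.conj).graph) :
    (inner ℂ x' y : ℂ) = inner ℂ y' x := by
  obtain ⟨u, rfl, hy⟩ := (A.mem_graph_preSmeared_iff_raise _ _ _ _).1 h
  obtain ⟨u', rfl, hy'⟩ := (A.mem_graph_preSmeared_iff_raise _ _ _ _).1 h'
  have h1 := (innerSL ℂ (u' : Hilb V)).hasSum hy
  have h2 := ((innerSL ℂ (u : Hilb V)).hasSum hy').star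
  rw [← (Equiv.neg ℤ).hasSum_iff] at h2
  simp only [innerSL_apply_apply, RCLike.star_def, inner_conj_symm] at h1 h2
  refine h1.unique ?_
  convert h2 using 2 with p
  simp only [Function.comp_apply, Equiv.neg_apply, inner_smul_left, inner_smul_right,
    UniformSpace.Completion.inner_coe]
  have h3 : f.conj.fourier p = starRingEnd ℂ (f.fourier (-p)) := by
    rw [← TestFn.fourier_conj, neg_neg]
  rw [neg_neg, h3, Complex.conj_conj, ← inner_conj_symm, A.inner_raise_left, inner_conj_symm]

theorem inner_closure_graph (v : V) (f : TestFn) {x y x' y' : Hilb V}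
    (h : (x, y) ∈ (A.preSmeared v f).graph.topologicalClosure)
    (h' : (x', y') ∈ (A.preSmeared (A.tilde v) f.conj).graph.topologicalClosure) :
    (inner ℂ x' y : ℂ) = inner ℂ y' x := by
  have key : closure ((A.preSmeared v f).graph : Set (Hilb V × Hilb V)) ×ˢ
      closure ((A.preSmeared (A.tilde v) f.conj).graph : Set (Hilb V × Hilb V)) ⊆
      {q | (inner ℂ q.2.1 q.1.2 : ℂ) = inner ℂ q.2.2 q.1.1} := by
    rw [← closure_prod_eq]
    refine closure_minimal (fun q hq => A.inner_graph_preSmeared v f hq.1 hq.2)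
      (isClosed_eq ?_ ?_) <;> fun_prop
  exact key (Set.mk_mem_prod h h')

/-- `Y⁰(v, f)` is closable because it has a densely defined formal adjoint. -/
theorem isClosable_preSmeared (v : V) (f : TestFn) : (A.preSmeared v f).IsClosable := by
  refine ⟨(A.preSmeared v f).graph.topologicalClosure.toLinearPMap,
    (Submodule.toLinearPMap_graph_eq _ ?_).symm⟩
  rintro ⟨x, y⟩ hq rfl
  -- `y` is orthogonal to the dense subspace `V`
  refine Dense.eq_zero_of_inner_right (𝕜 := ℂ) (UniformSpace.Completion.denseRange_coe (α := V)) ?_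
  rintro _ ⟨u, rfl⟩
  obtain ⟨y', hy'⟩ := A.exists_mem_graph_preSmeared (A.tilde v) f.conj u
  rw [A.inner_closure_graph v f hq (Submodule.le_topologicalClosure _ hy'), inner_zero_right]

theorem graph_smeared (v : V) (f : TestFn) :
    (A.smeared v f).graph = (A.preSmeared v f).graph.topologicalClosure :=
  (A.isClosable_preSmeared v f).graph_closure_eq_closure_graph.symm

/-- A vector is tempered if it is the sum of a series of modes of a product of fields applied to
the vacuum, with rapidly decreasing coefficients. -/
def IsTempered (x : Hilb V) : Prop :=
  ∃ (G : Type) (_ : SeminormedAddCommGroup G) (T : G → Module.End ℂ V) (c : G → ℂ),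
    A.FieldProduct T ∧ (∀ M : ℕ, Summable fun n => ‖c n‖ * (1 + ‖n‖) ^ M) ∧
      HasSum (fun n => c n • ((T n A.vac : V) : Hilb V)) x

variable {A}

theorem isTempered_vac : A.IsTempered (A.vac : Hilb V) := by
  refine ⟨PUnit, inferInstance, _, fun _ => 1, .one, fun M => Summable.of_finite, ?_⟩
  simp only [one_smul, Module.End.one_apply]
  exact hasSum_unique fun n : PUnit => ((A.vac : V) : Hilb V)

theorem one_add_norm_prod_le {G G' : Type*} [SeminormedAddCommGroup G] [SeminormedAddCommGroup G']
    (q : G × G') : 1 + ‖q‖ ≤ (1 + ‖q.1‖) * (1 + ‖q.2‖) := by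
  have h1 := norm_nonneg q.1
  have h2 := norm_nonneg q.2
  rw [Prod.norm_def]
  nlinarith [max_le_add_of_nonneg h1 h2, mul_nonneg h1 h2]

/-- Tempered vectors lie in the domain of every smeared field `Y(v, f)`, which maps them to tempered
vectors; the result is obtained by smearing the polynomially bounded sequence of the vectors
`v_n x`. -/
theorem IsTempered.smear {x : Hilb V} (hx : A.IsTempered x) (v : V) :
    ∃ z : ℤ → Hilb V, PolyBounded z ∧ ∀ f : TestFn, ∃ y,
      HasSum (fun n => f.fourier n • z n) y ∧ (x, y) ∈ (A.smeared v f).graph ∧ A.IsTempered y := by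
  obtain ⟨G, _, T, c, hT, hc, hx⟩ := hx
  have hT' : A.FieldProduct fun q : ℤ × G => A.raise v q.1 * T q.2 := .mul v hT
  obtain ⟨C, M, hC, hCM⟩ := polyBounded_apply hT' A.vac
  have hbd (p : ℤ) (n : G) : ‖(A.raise v p) (T n A.vac)‖ ≤
      C * ((1 + ‖p‖) ^ M * (1 + ‖n‖) ^ M) := by
    refine (hCM (p, n)).trans ?_
    rw [← mul_pow]
    gcongr
    exact one_add_norm_prod_le (p, n)
  have hterm (p : ℤ) (n : G) : ‖c n • ((A.raise v p (T n A.vac) : V) : Hilb V)‖ ≤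
      C * (1 + ‖p‖) ^ M * (‖c n‖ * (1 + ‖n‖) ^ M) := by
    rw [norm_smul, UniformSpace.Completion.norm_coe]
    calc ‖c n‖ * _ ≤ ‖c n‖ * (C * ((1 + ‖p‖) ^ M * (1 + ‖n‖) ^ M)) := by gcongr; exact hbd p n
      _ = _ := by ring
  have hsum (p : ℤ) : Summable fun n => c n • ((A.raise v p (T n A.vac) : V) : Hilb V) :=
    .of_norm_bounded ((hc M).mul_left (C * (1 + ‖p‖) ^ M)) (hterm p)
  refine ⟨fun n => ∑' k, c k • ((A.raise v (-n) (T k A.vac) : V) : Hilb V),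
    ⟨C * ∑' k, ‖c k‖ * (1 + ‖k‖) ^ M, M, mul_nonneg hC (tsum_nonneg fun _ => by positivity),
      fun n => ?_⟩, fun f => ?_⟩
  · refine (tsum_of_norm_bounded ((hc M).hasSum.mul_left (C * (1 + ‖n‖) ^ M)) fun k => ?_).trans
      (le_of_eq (by ring))
    simpa only [norm_neg] using hterm (-n) k
  · -- all multiple sums below converge absolutely
    have hrapid (N : ℕ) : Summable fun q : ℤ × G =>
        ‖f.fourier (-q.1) * c q.2‖ * (1 + ‖q‖) ^ N := by
      have h1 : Summable fun p : ℤ => ‖f.fourier (-p)‖ * (1 + ‖p‖) ^ N := by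
        rw [← (Equiv.neg ℤ).summable_iff]
        simpa [Function.comp_def] using f.summable_fourier_mul_pow N
      refine .of_nonneg_of_le (fun _ => by positivity) (fun q => ?_)
        (h1.mul_of_nonneg (hc N) (fun _ => by positivity) fun _ => by positivity)
      rw [norm_mul, mul_mul_mul_comm, ← mul_pow]
      gcongr
      exact one_add_norm_prod_le q
    have hS : Summable fun q : ℤ × G =>
        (f.fourier (-q.1) * c q.2) • ((A.raise v q.1 (T q.2 A.vac) : V) : Hilb V) := by
      refine .of_norm_bounded ((hrapid M).mul_left C) fun q => ?_
      rw [norm_smul, UniformSpace.Completion.norm_coe]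
      calc _ ≤ ‖f.fourier (-q.1) * c q.2‖ * (C * (1 + ‖q‖) ^ M) := by gcongr; exact hCM q
        _ = _ := by ring
    refine ⟨_, ?_, ?_, ℤ × G, inferInstance, _, _, hT', hrapid, hS.hasSum⟩
    · -- summation over `n : G` first
      have h1 := hS.hasSum.prod_fiberwise fun p => by
        simpa only [mul_smul] using (hsum p).hasSum.const_smul (f.fourier (-p))
      rw [← (Equiv.neg ℤ).hasSum_iff] at h1
      simpa [Function.comp_def] using h1
    · -- the pair is the limit of the pairs of partial sums over `n : G`, which lie in the graph of
      -- `Y⁰(v, f)`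
      rw [graph_smeared]
      have hu (n : G) := A.exists_mem_graph_preSmeared v f (T n A.vac)
      choose y hy using hu
      have h2 : HasSum (fun n => c n • y n) (∑' q : ℤ × G,
          (f.fourier (-q.1) * c q.2) • ((A.raise v q.1 (T q.2 A.vac) : V) : Hilb V)) := by
        have h3 := ((Equiv.prodComm G ℤ).hasSum_iff.2 hS.hasSum)
        refine h3.prod_fiberwise fun n => ?_
        obtain ⟨u, hu, h4⟩ := (A.mem_graph_preSmeared_iff_raise _ _ _ _).1 (hy n)
        obtain rfl := UniformSpace.Completion.coe_injective V hu
        simpa [Function.comp_def, smul_smul, mul_comm] using h4.const_smul (c n)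
      refine mem_closure_of_tendsto (hx.prodMk_nhds h2) (.of_forall fun s => ?_)
      have h5 := (A.preSmeared v f).graph.sum_mem (t := s)
        fun n _ => Submodule.smul_mem _ (c n) (hy n)
      have h6 : ∑ n ∈ s, c n • (((T n A.vac : V) : Hilb V), y n) =
          (∑ n ∈ s, c n • ((T n A.vac : V) : Hilb V), ∑ n ∈ s, c n • y n) := by
        rw [Prod.ext_iff, Prod.fst_sum, Prod.snd_sum]
        exact ⟨rfl, rfl⟩
      rwa [h6] at h5

theorem isTempered_of_isIterated {x : Hilb V} (hx : A.IsIterated x) : A.IsTempered x := by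
  induction hx with
  | vac => exact isTempered_vac
  | smear v f x _ ih =>
    obtain ⟨z, _, hz⟩ := ih.smear v
    obtain ⟨y, _, hxy, hy⟩ := hz f
    rwa [← (LinearPMap.image_iff x.2).2 hxy]

/-- On a vector of `D`, a smeared field is given by smearing a polynomially bounded sequence of
vectors. -/
theorem exists_modes_of_mem_D {x : Hilb V} (hx : x ∈ A.D) (v : V) :
    ∃ z : ℤ → Hilb V, PolyBounded z ∧ ∀ f : TestFn, ∃ y,
      HasSum (fun n => f.fourier n • z n) y ∧ (x, y) ∈ (A.smeared v f).graph := by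
  induction hx using Submodule.span_induction with
  | mem x hx =>
    obtain ⟨z, hz, h⟩ := (isTempered_of_isIterated hx).smear v
    exact ⟨z, hz, fun f => (h f).imp fun y hy => ⟨hy.1, hy.2.1⟩⟩
  | zero => exact ⟨0, .const 0, fun f => ⟨0, by simp, zero_mem _⟩⟩
  | add x x' _ _ h h' =>
    obtain ⟨z, hz, h⟩ := h
    obtain ⟨z', hz', h'⟩ := h'
    refine ⟨fun n => z n + z' n, hz.add hz', fun f => ?_⟩
    obtain ⟨y, hy, hxy⟩ := h f
    obtain ⟨y', hy', hxy'⟩ := h' f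
    exact ⟨y + y', by simpa only [smul_add] using hy.add hy', add_mem hxy hxy'⟩
  | smul c x _ h =>
    obtain ⟨z, ⟨C, M, hC, hz⟩, h⟩ := h
    refine ⟨fun n => c • z n, ⟨‖c‖ * C, M, by positivity, fun n => ?_⟩, fun f => ?_⟩
    · rw [norm_smul, mul_assoc]
      gcongr
      exact hz n
    · obtain ⟨y, hy, hxy⟩ := h f
      exact ⟨c • y, by simpa only [smul_comm c] using hy.const_smul c, Submodule.smul_mem _ c hxy⟩

theorem D_le_domain_smeared (v : V) (f : TestFn) : A.D ≤ (A.smeared v f).domain := fun _ hx =>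
  have ⟨_, _, h⟩ := exists_modes_of_mem_D hx v
  have ⟨_, _, hy⟩ := h f
  LinearPMap.mem_domain_of_mem_graph hy

theorem coe_mem_D (u : V) : (u : Hilb V) ∈ A.D := by
  induction u using A.homogeneous_induction with
  | zero => exact UniformSpace.Completion.coe_zero (α := V) ▸ zero_mem _
  | add u w hu hw => exact UniformSpace.Completion.coe_add u w ▸ add_mem hu hw
  | wt d u hu =>
    -- smearing with `z ↦ z ^ (-d)` selects the mode `u_{-d}`, and `u_{-d} Ω = u`
    have h : ((A.vac : Hilb V), (u : Hilb V)) ∈ (A.smeared u (.negPow d)).graph := by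
      rw [graph_smeared]
      refine Submodule.le_topologicalClosure _
        ((A.mem_graph_preSmeared_iff_raise _ _ _ _).2 ⟨A.vac, rfl, ?_⟩)
      have h1 := hasSum_ite_eq (d : ℤ) (u : Hilb V)
      convert h1 using 2 with p
      simp only [TestFn.fourier_negPow, neg_inj]
      split_ifs with hp
      · rw [hp, one_smul, A.raise_vac hu]
      · rw [zero_smul]
    have h2 := (LinearPMap.image_iff (LinearPMap.mem_domain_of_mem_graph h)).2 h
    rw [h2]
    exact Submodule.subset_span (.smear u _ ⟨_, LinearPMap.mem_domain_of_mem_graph h⟩ .vac)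

theorem dense_D : Dense (A.D : Set (Hilb V)) :=
  (UniformSpace.Completion.denseRange_coe (α := V)).mono
    (Set.range_subset_iff.2 coe_mem_D)

variable (A)

/-- The restriction of `Y(v, f)` to `D`. -/
def smearedOnD (v : V) (f : TestFn) : A.D →ₗ[ℂ] Hilb V :=
  (A.smeared v f).toFun ∘ₗ Submodule.inclusion (D_le_domain_smeared v f)

theorem mem_graph_smearedOnD (v : V) (f : TestFn) (x : A.D) :
    ((x : Hilb V), A.smearedOnD v f x) ∈ (A.smeared v f).graph :=
  (A.smeared v f).mem_graph (Submodule.inclusion (D_le_domain_smeared v f) x)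

theorem exists_hasSum_smearedOnD (v : V) (x : A.D) : ∃ z : ℤ → Hilb V, PolyBounded z ∧
    ∀ f : TestFn, HasSum (fun n => f.fourier n • z n) (A.smearedOnD v f x) := by
  obtain ⟨z, hz, h⟩ := exists_modes_of_mem_D x.2 v
  refine ⟨z, hz, fun f => ?_⟩
  obtain ⟨y, hy, hxy⟩ := h f
  rwa [(A.smeared v f).mem_graph_snd_inj (A.mem_graph_smearedOnD v f x) hxy rfl]

/-- `Y(v, f)|_D` as a linear map of the test function `f`. -/
def smearedLinearMap (v : V) : TestFn →ₗ[ℂ] (A.D →ₗ[ℂ] Hilb V) where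
  toFun := A.smearedOnD v
  map_add' f g := by
    ext x
    obtain ⟨z, _, h⟩ := A.exists_hasSum_smearedOnD v x
    refine (h (f + g)).unique ?_
    simp only [TestFn.fourier_add, add_smul]
    exact (h f).add (h g)
  map_smul' c f := by
    ext x
    obtain ⟨z, _, h⟩ := A.exists_hasSum_smearedOnD v x
    refine (h (c • f)).unique ?_
    simp only [TestFn.fourier_smul, mul_smul]
    exact (h f).const_smul c

/-- The operator-valued distribution `f ↦ Y(v, f)|_D`. -/
def smearedDistribution (v : V) : OperatorValuedDistribution A.D where
  dense := dense_D
  toFun := A.smearedLinearMap v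
  continuous_apply x := by
    obtain ⟨z, hz, h⟩ := A.exists_hasSum_smearedOnD v x
    exact TestFn.continuous_of_hasSum hz (LinearMap.applyₗ x ∘ₗ A.smearedLinearMap v) h

theorem isAdjoint_smearedDistribution (v : V) :
    (A.smearedDistribution v).IsAdjoint (A.smearedDistribution (A.tilde v)) := fun f x x' => by
  have h := A.mem_graph_smearedOnD v f x
  have h' := A.mem_graph_smearedOnD (A.tilde v) f.conj x'
  rw [graph_smeared] at h h'
  exact A.inner_closure_graph v f h h'

end UnitaryMoebiusVertexAlgebra

end

theorem mainTheorem5 {V : Type*} [NormedAddCommGroup V] [InnerProductSpace ℂ V]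
    (A : UnitaryMoebiusVertexAlgebra V) :
    -- the smeared fields exist: `Y⁰(v, f)` is defined on all of `V` and is closable
    (∀ (v : V) (f : TestFn),
      (∀ u : V, (u : UnitaryMoebiusVertexAlgebra.Hilb V) ∈ (A.preSmeared v f).domain) ∧
      (A.preSmeared v f).IsClosable) ∧
    ∃ φ : V → OperatorValuedDistribution A.D,
      -- `D` lies in the domain of `Y(v, f)`, and `φ_v(f) = Y(v, f)|_D`
      (∀ (v : V) (f : TestFn),
        A.D ≤ (A.smeared v f).domain ∧ (φ v).op f = (A.smeared v f).domRestrict A.D) ∧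
      -- `φ_v` is adjointable with `φ_v† = φ_ṽ`, where `ṽ = e^{L₁} (-1)^{L₀} Θ v`
      ∀ v : V, ∃ h : (φ v).IsAdjointable, (φ v).adjoint h = φ (A.tilde v) := by
  refine ⟨fun v f => ⟨fun u => ?_, A.isClosable_preSmeared v f⟩, A.smearedDistribution,
    fun v f => ⟨UnitaryMoebiusVertexAlgebra.D_le_domain_smeared v f, ?_⟩, fun v => ?_⟩
  · obtain ⟨y, hy⟩ := A.exists_mem_graph_preSmeared v f u
    exact LinearPMap.mem_domain_of_mem_graph hy
  · refine LinearPMap.ext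
      (inf_eq_left.2 (UnitaryMoebiusVertexAlgebra.D_le_domain_smeared v f)).symm ?_
    intro x hx hx'
    exact (LinearPMap.domRestrict_apply (f := A.smeared v f) (x := ⟨x, hx'⟩)
      (y := ⟨x, UnitaryMoebiusVertexAlgebra.D_le_domain_smeared v f hx⟩) rfl).symm
  · have h := A.isAdjoint_smearedDistribution v
    exact ⟨⟨_, h⟩, (OperatorValuedDistribution.isAdjoint_adjoint _ _).unique h⟩
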